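/- Let $(X,|\cdot|)$ be a Banach space and let $\Phi$ be a special Bernstein function: $\Phi:(0,\infty)\to(0,\infty)$ is a Bernstein function and so is $\lambda\mapsto\lambda/\Phi(\lambda)$. Assume that $\Phi$ has no killing and no drift and has an infinite Lévy measure $\nu$, i.e. $\Phi(\lambda)=\int_0^\infty(1-e^{-\lambda x})\,\nu(dx)$ with $\int_0^\infty(1\wedge x)\,\nu(dx)<\infty$ and $\nu(0,\infty)=\infty$. Let $\sigma$ be the subordinator with Laplace exponent $\Phi$, let $\mathcal L(t)=\inf\{y>0:\sigma(y)>t\}$ be its inverse, and set $$\mathfrak e_\Phi(t;\lambda)=\mathbb E\big[e^{\lambda \mathcal L(t)}\big].$$ Let $u_\Phi$ be the potential density of $\sigma$, i.e. the Lebesgue density of the potential measure $A\mapsto\mathbb E\int_0^\infty \mathbf 1_A(\sigma(s))\,ds$, and assume that there are $t_0>0$, $C>0$, $\beta\in(0,1)$ with $u_\Phi(t)\le Ct^{\beta-1}$ for $t\in(0,t_0)$. With $\bar\nu(t)=\nu(t,\infty)$, the generalized Caputo derivative of a continuous function $f$ on $[0,T']$ is $$\partial_t^\Phi f(t)=\frac{d}{dt}\int_0^t\bar\nu(t-s)\,(f(s)-f(0))\,ds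 ;$$ it is said to exist on $[0,T']$ if the integral is an absolutely continuous function of $t\in[0,T']$ that is differentiable at almost every $t$. Let $T>0$ and let $F:[0,T]\times X\to X$ be such that $F(\cdot,x)$ is strongly measurable for every $x\in X$. Write $B_r(x)$ for the open ball of centre $x$ and radius $r$, and assume: * (A1) for every $r>0$ there is $C_r>0$ such that, for almost every $t\in[0,T]$, $|F(t,x)|\le C_r$ for all $x\in B_r(0)$; * (A2) for every $r>0$ there is $L_r>0$ such that, for almost every $t\in[0,T]$, $|F(t,x)-F(t,z)|\le L_r|x-z|$ for all $x,z\in B_r(0)$. Fix $f_0\in X$ and $R>0$. 1. There is $T'\in(0,T]$ such that for every $\tilde f_0\in B_1(f_0)$ the problem $$\partial_t^\Phi f(t)=F(t,f(t))\ \text{ for a.e. } t\in[0,T'],\qquad f(0)=\tilde f_0,$$ has exactly one solution $f\in C([0,T'],B_R(\tilde f_0))$. 2. Let $T'\in(0,T]$ be any number with this property, and let $\Psi(\cdot;\tilde f_0)$ denote the solution with initial datum $\tilde f_0$. Then the map $\Psi:B_1(f_0)\to C([0,T'],X)$ is continuous at $f_0$ (for the supremum norm). Moreover, for every constant $L>0$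 that is admissible as $L_r$ in (A2) for $r=R+1+|f_0|$, the quantity $\mathfrak e_\Phi(T';L)$ is finite and $$\max_{t\in[0,T']}|\Psi(t;\tilde f_0)-\Psi(t;f_0)|\le|\tilde f_0-f_0|\;\mathfrak e_\Phi(T';L)\qquad\text{for all }\tilde f_0\in B_1(f_0).$$ -/

import Mathlib

open MeasureTheory ProbabilityTheory Set Filter Topology
open scoped NNReal ENNReal

/-- Bernstein functions on `(0, ∞)`: smooth, non-negative, `(-1)^n Φ^(n) ≤ 0` for `n ≥ 1`. -/
structure IsBernstein (Φ : ℝ → ℝ) : Prop where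
  contDiffOn : ContDiffOn ℝ ((⊤ : ℕ∞) : WithTop ℕ∞) Φ (Ioi 0)
  nonneg : ∀ z : ℝ, 0 < z → 0 ≤ Φ z
  iteratedDeriv_nonpos : ∀ n : ℕ, 1 ≤ n → ∀ z : ℝ, 0 < z → (-1 : ℝ) ^ n * iteratedDeriv n Φ z ≤ 0

/-- Special Bernstein functions: the conjugate `z ↦ z / Φ z` is again a Bernstein function
(`Φ` has no zero in `(0, ∞)`, so that the conjugate makes sense). -/
structure IsSpecialBernstein (Φ : ℝ → ℝ) : Prop where
  isBernstein : IsBernstein Φ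
  ne_zero : ∀ z : ℝ, 0 < z → Φ z ≠ 0
  conjugate : IsBernstein (fun z => z / Φ z)

/-- `(a, b, ν)` is the Lévy triple of `Φ`: `a, b ≥ 0`, `ν` is a measure carried by `(0, ∞)` with
`∫ (1 ∧ x) ν(dx) < ∞`, and `Φ z = a + b z + ∫ (1 - e^{-z x}) ν(dx)` for `z > 0`. -/
structure IsLevyTriple (Φ : ℝ → ℝ) (a b : ℝ) (ν : Measure ℝ) : Prop where
  a_nonneg : 0 ≤ a
  b_nonneg : 0 ≤ b
  carried : ν (Iic 0) = 0
  lintegral_lt_top : ∫⁻ x in Ioi (0 : ℝ), ENNReal.ofReal (min 1 x) ∂ν < ∞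
  eq : ∀ z : ℝ, 0 < z → Φ z = a + b * z + ∫ x in Ioi (0 : ℝ), (1 - Real.exp (-(z * x))) ∂ν

/-- The tail `ν̄(t) = ν(t, ∞)` (finite for `t > 0`). -/
noncomputable def levyTail (ν : Measure ℝ) (t : ℝ) : ℝ := ν.real (Ioi t)

/-- A subordinator: a real Lévy process with non-decreasing paths (started at `0`, independent and
stationary increments, almost all paths non-decreasing and right-continuous). -/
structure IsSubordinator {Ω : Type*} [MeasurableSpace Ω] (P : Measure Ω) (σ : ℝ≥0 → Ω → ℝ) :
    Prop where
  measurable : ∀ s, Measurable (σ s)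
  zero : ∀ᵐ ω ∂P, σ 0 ω = 0
  indep : HasIndepIncrements σ P
  stationary : ∀ s h : ℝ≥0, IdentDistrib (fun ω => σ (s + h) ω - σ s ω) (σ h) P P
  monotone : ∀ᵐ ω ∂P, Monotone (fun s => σ s ω)
  rightCont : ∀ᵐ ω ∂P, ∀ s : ℝ≥0, ContinuousWithinAt (fun r => σ r ω) (Ici s) s

/-- `σ` has Laplace exponent `Φ`: `E[e^{-z σ(s)}] = e^{-s Φ(z)}`. -/
def HasLaplaceExponent {Ω : Type*} [MeasurableSpace Ω] (P : Measure Ω) (σ : ℝ≥0 → Ω → ℝ)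
    (Φ : ℝ → ℝ) : Prop :=
  ∀ (s : ℝ≥0) (z : ℝ), 0 < z → ∫ ω, Real.exp (-(z * σ s ω)) ∂P = Real.exp (-((s : ℝ) * Φ z))

/-- The potential (occupation) measure `U(A) = E[∫_0^∞ 1_A(σ(s)) ds]`, written as the image of
`P ⊗ ds` under `(ω, s) ↦ σ(s)(ω)`. -/
noncomputable def potentialMeasure {Ω : Type*} [MeasurableSpace Ω] (P : Measure Ω)
    (σ : ℝ≥0 → Ω → ℝ) : Measure ℝ :=
  (P.prod (volume.restrict (Ici (0 : ℝ)))).map (fun p : Ω × ℝ => σ p.2.toNNReal p.1)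

/-- The potential density `u`: the Lebesgue density of the potential measure. -/
noncomputable def potentialDensity {Ω : Type*} [MeasurableSpace Ω] (P : Measure Ω)
    (σ : ℝ≥0 → Ω → ℝ) : ℝ → ℝ≥0∞ :=
  (potentialMeasure P σ).rnDeriv volume

/-- The inverse subordinator `L(t) = inf {y > 0 : σ(y) > t}`. -/
noncomputable def inverseSubordinator {Ω : Type*} (σ : ℝ≥0 → Ω → ℝ) (t : ℝ) (ω : Ω) : ℝ≥0 :=
  sInf {y : ℝ≥0 | 0 < y ∧ t < σ y ω}

/-- The `Φ`-exponential function `𝔢_Φ(t; l) = E[e^{l L(t)}]`. -/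
noncomputable def phiExp {Ω : Type*} [MeasurableSpace Ω] (P : Measure Ω) (σ : ℝ≥0 → Ω → ℝ)
    (t l : ℝ) : ℝ :=
  ∫ ω, Real.exp (l * (inverseSubordinator σ t ω : ℝ)) ∂P

section Caputo

variable {X : Type*} [NormedAddCommGroup X] [NormedSpace ℝ X]

/-- `∫_0^t ν̄(t - s) (f(s) - f(0)) ds`, whose derivative in `t` is the generalized Caputo
derivative of `f`. -/
noncomputable def caputoPrimitive (ν : Measure ℝ) (f : ℝ → X) (t : ℝ) : X :=
  ∫ s in (0 : ℝ)..t, levyTail ν (t - s) • (f s - f 0)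

/-- `f` has the generalized Caputo derivative `g` on `[0, T]`: the function
`t ↦ ∫_0^t ν̄(t - s) (f(s) - f(0)) ds` is absolutely continuous on `[0, T]` and has derivative
`g t` at almost every `t ∈ [0, T]`. -/
structure HasCaputoDerivOn (ν : Measure ℝ) (T : ℝ) (f g : ℝ → X) : Prop where
  absCont : AbsolutelyContinuousOnInterval (caputoPrimitive ν f) 0 T
  ae_hasDerivAt : ∀ᵐ t ∂(volume.restrict (Icc (0 : ℝ) T)),
    HasDerivAt (caputoPrimitive ν f) (g t) t

/-- `f ∈ C([0, T], B_R(x₀))` solves `∂^Φ f(t) = F(t, f(t))` for a.e. `t ∈ [0, T]`, `f(0) = x₀`.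
Only the values of `f` on `[0, T]` matter; `IccExtend` extends `f` by constants. -/
structure IsCauchySolution (ν : Measure ℝ) (F : ℝ → X → X) {T : ℝ} (hT : 0 ≤ T) (R : ℝ) (x₀ : X)
    (f : C(Icc (0 : ℝ) T, X)) : Prop where
  mem_ball : ∀ t, f t ∈ Metric.ball x₀ R
  init : f ⟨0, left_mem_Icc.2 hT⟩ = x₀
  eqn : HasCaputoDerivOn ν T (IccExtend hT f) (fun t => F t (IccExtend hT f t))

/-- Every initial datum in `B_1(f₀)` has exactly one solution on `[0, T]` with values in the ball
of radius `R` around that datum. -/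
def IsCommonExistenceTime (ν : Measure ℝ) (F : ℝ → X → X) {T : ℝ} (hT : 0 ≤ T) (R : ℝ)
    (f₀ : X) : Prop :=
  ∀ x₀ ∈ Metric.ball f₀ 1, ∃! f : C(Icc (0 : ℝ) T, X), IsCauchySolution ν F hT R x₀ f

/-- Local boundedness: on every ball `B_R` there is `C_R > 0` with `|F(t, x)| ≤ C_R` for a.e.
`t ∈ [0, T]` and all `x ∈ B_R`. -/
def LocallyBoundedOn (T : ℝ) (F : ℝ → X → X) : Prop :=
  ∀ R : ℝ, ∃ C : ℝ, 0 < C ∧ ∀ᵐ t ∂(volume.restrict (Icc (0 : ℝ) T)),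
    ∀ x ∈ Metric.ball (0 : X) R, ‖F t x‖ ≤ C

/-- `L` is a Lipschitz constant of `F(t, ·)` on `B_R` for a.e. `t ∈ [0, T]`. -/
def LipschitzConstOn (T : ℝ) (F : ℝ → X → X) (R L : ℝ) : Prop :=
  ∀ᵐ t ∂(volume.restrict (Icc (0 : ℝ) T)),
    ∀ x ∈ Metric.ball (0 : X) R, ∀ z ∈ Metric.ball (0 : X) R, ‖F t x - F t z‖ ≤ L * ‖x - z‖

end Caputo

/-! The Cauchy problem is turned into a Volterra equation. Let `U` be the potential measure and
`N(dt) = ν(t, ∞) dt`. Their Laplace transforms are `1/Φ(z)` and `Φ(z)/z`, so `U ∗ N` has transform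
`1/z` and is Lebesgue measure on the half-line (`potentialMeasure_conv_tailMeasure`). Since the
Caputo derivative is the derivative of `N ∗ (f - f(0))`, convolving with `U` makes the problem
equivalent to `f = f(0) + U ∗ F(·, f)` (`hasCaputoDerivOn_iff`, `isCauchySolution_iff`).

Two properties of `U` make this equation tractable. It is absolutely continuous, because `z ·
(1/Φ(z))` is again a Bernstein function: this makes the Post-Widder inversion densities monotone,
hence locally bounded uniformly in `n` (`absolutelyContinuous_of_laplace`). Consequently `U ∗ k` is
continuous for bounded measurable `k`, and conditions holding for a.e. time survive the convolution.
Moreover `Φ → ∞` because `ν` is infinite, so `U[0, T']` is small for small `T'` and Picard iteration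
contracts (`exists_integral_solution`).

For the stability estimate, let `V` be the potential measure with weight `e^{l s}`, of transform
`1/(Φ - l)`. The identity `V = U + l U ∗ V` says that `1 + l V[0, t]` solves the renewal equation
with kernel `l U`. By integrating `e^{l s}` up to the passage time, this function equals `𝔢_Φ(t; l)`
(`ofReal_phiExp`). Iterating the inequality `m ≤ a + l U ∗ m` gives `m ≤ a 𝔢_Φ(·; l)`
(`gronwall_potentialMeasure`), which yields uniqueness and Lipschitz dependence on the datum
together. -/

/-! ### Laplace transforms of measures and their uniqueness. -/

/-- The (extended real) Laplace transform of a measure on `ℝ`. -/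
noncomputable def laplace (μ : Measure ℝ) (z : ℝ) : ℝ≥0∞ :=
  ∫⁻ x, ENNReal.ofReal (Real.exp (-(z * x))) ∂μ

lemma laplace_antitone {μ : Measure ℝ} (hμ : μ (Iio 0) = 0) {z w : ℝ} (h : z ≤ w) :
    laplace μ w ≤ laplace μ z := by
  refine lintegral_mono_ae ?_
  have : ∀ᵐ x ∂μ, x ∉ Iio (0 : ℝ) := measure_eq_zero_iff_ae_notMem.1 hμ
  filter_upwards [this] with x hx
  simp only [mem_Iio, not_lt] at hx
  gcongr

lemma laplace_conv (μ ν : Measure ℝ) [SFinite ν] (z : ℝ) :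
    laplace (μ ∗ ν) z = laplace μ z * laplace ν z := by
  unfold laplace
  rw [Measure.lintegral_conv (by fun_prop), ← lintegral_mul_const _ (by fun_prop)]
  refine lintegral_congr fun x => ?_
  rw [← lintegral_const_mul _ (by fun_prop)]
  refine lintegral_congr fun y => ?_
  rw [← ENNReal.ofReal_mul (by positivity), ← Real.exp_add]
  ring_nf

/-- The exponentially tilted measure. -/
noncomputable def expTilt (μ : Measure ℝ) (z : ℝ) : Measure ℝ :=
  μ.withDensity fun x => ENNReal.ofReal (Real.exp (-(z * x)))

lemma lintegral_expTilt (μ : Measure ℝ) (z t : ℝ) :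
    ∫⁻ x, ENNReal.ofReal (Real.exp (t * x)) ∂(expTilt μ z) = laplace μ (z - t) := by
  unfold expTilt laplace
  rw [lintegral_withDensity_eq_lintegral_mul _ (by fun_prop) (by fun_prop)]
  refine lintegral_congr fun x => ?_
  simp only [Pi.mul_apply]
  rw [← ENNReal.ofReal_mul (by positivity), ← Real.exp_add]
  ring_nf

lemma expTilt_expTilt (μ : Measure ℝ) (z w : ℝ) :
    expTilt (expTilt μ z) w = expTilt μ (z + w) := by
  unfold expTilt
  rw [← withDensity_mul _ (by fun_prop) (by fun_prop)]
  congr 1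
  funext x
  simp only [Pi.mul_apply]
  rw [← ENNReal.ofReal_mul (by positivity), ← Real.exp_add]
  ring_nf

lemma expTilt_zero (μ : Measure ℝ) : expTilt μ 0 = μ := by
  simp [expTilt]

lemma integrable_exp_expTilt {μ : Measure ℝ} {z t : ℝ} (h : laplace μ (z - t) < ∞) :
    Integrable (fun x => Real.exp (t * x)) (expTilt μ z) := by
  refine ⟨by fun_prop, ?_⟩
  rw [hasFiniteIntegral_iff_ofReal (Eventually.of_forall fun x => by positivity),
    lintegral_expTilt]
  exact h

lemma isFiniteMeasure_expTilt {μ : Measure ℝ} {z : ℝ} (h : laplace μ z < ∞) :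
    IsFiniteMeasure (expTilt μ z) := by
  refine ⟨?_⟩
  have := lintegral_expTilt μ z 0
  simp only [zero_mul, Real.exp_zero, ENNReal.ofReal_one, lintegral_one, sub_zero] at this
  rwa [this]

lemma sigmaFinite_of_laplace {μ : Measure ℝ} {z : ℝ} (h : laplace μ z < ∞) : SigmaFinite μ := by
  have := isFiniteMeasure_expTilt h
  have h2 : expTilt (expTilt μ z) (-z) = μ := by rw [expTilt_expTilt, add_neg_cancel, expTilt_zero]
  rw [← h2]
  unfold expTilt at this ⊢
  exact SigmaFinite.withDensity_ofReal _

/-- Measures on `[0, ∞)` are determined by their Laplace transforms near infinity. -/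
theorem Measure.ext_of_laplace {μ ν : Measure ℝ} (hμ : μ (Iio 0) = 0) (hν : ν (Iio 0) = 0)
    (z₀ : ℝ) (hfin : laplace μ z₀ < ∞) (h : ∀ z, z₀ ≤ z → laplace μ z = laplace ν z) :
    μ = ν := by
  have hfinν : laplace ν z₀ < ∞ := by rwa [← h z₀ le_rfl]
  -- The tilt by `z₀ + 1` makes both measures finite, with moment generating functions finite for `t
  -- < 1`; the extra `1` puts the imaginary axis inside the strip of analyticity.
  have key : expTilt μ (z₀ + 1) = expTilt ν (z₀ + 1) := by
    have hset : ∀ {ρ : Measure ℝ}, ρ (Iio 0) = 0 → laplace ρ z₀ < ∞ →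
        Iio (1 : ℝ) ⊆ interior (integrableExpSet id (expTilt ρ (z₀ + 1))) := by
      intro ρ h0 h1
      refine interior_maximal (fun t ht => ?_) isOpen_Iio
      exact integrable_exp_expTilt ((laplace_antitone h0 (by simp at ht; linarith)).trans_lt h1)
    have h1 := isFiniteMeasure_expTilt ((laplace_antitone hμ (by linarith : z₀ ≤ z₀ + 1)).trans_lt hfin)
    have h2 := isFiniteMeasure_expTilt ((laplace_antitone hν (by linarith : z₀ ≤ z₀ + 1)).trans_lt hfinν)
    have hmgf : ∀ t < 1, mgf id (expTilt μ (z₀ + 1)) t = mgf id (expTilt ν (z₀ + 1)) t := by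
      intro t ht
      simp only [mgf, id]
      rw [integral_eq_lintegral_of_nonneg_ae (Eventually.of_forall fun x => by positivity)
        (by fun_prop), integral_eq_lintegral_of_nonneg_ae
        (Eventually.of_forall fun x => by positivity) (by fun_prop),
        lintegral_expTilt, lintegral_expTilt, h _ (by linarith)]
    -- The transforms agree at real points near `0`, so by analytic continuation on the whole strip
    -- `Re z < 1`; on the imaginary axis they are the characteristic functions.
    have heq : EqOn (complexMGF id (expTilt μ (z₀ + 1))) (complexMGF id (expTilt ν (z₀ + 1)))
        {z | z.re ∈ Iio (1 : ℝ)} := by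
      have hA := (analyticOnNhd_complexMGF (X := id) (μ := expTilt μ (z₀ + 1))).mono
        (fun z (hz : z.re ∈ Iio (1:ℝ)) => hset hμ hfin hz)
      have hB := (analyticOnNhd_complexMGF (X := id) (μ := expTilt ν (z₀ + 1))).mono
        (fun z (hz : z.re ∈ Iio (1:ℝ)) => hset hν hfinν hz)
      refine AnalyticOnNhd.eqOn_of_preconnected_of_frequently_eq hA hB
        ((convex_Iio (1:ℝ)).linear_preimage Complex.reLm).isPreconnected
        (z₀ := ((0 : ℝ) : ℂ)) (by simp) ?_
      have hr : ∃ᶠ x : ℝ in 𝓝[≠] (0 : ℝ), complexMGF id (expTilt μ (z₀ + 1)) x =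
          complexMGF id (expTilt ν (z₀ + 1)) x := by
        refine Eventually.frequently ?_
        filter_upwards [nhdsWithin_le_nhds (Iio_mem_nhds (one_pos : (0:ℝ) < 1))] with t ht
        rw [complexMGF_ofReal, complexMGF_ofReal, hmgf t ht]
      refine Tendsto.frequently (tendsto_nhdsWithin_iff.2 ⟨?_, ?_⟩) hr
      · exact (Complex.continuous_ofReal.tendsto 0).mono_left nhdsWithin_le_nhds
      · filter_upwards [self_mem_nhdsWithin] with t ht
        simpa using ht
    refine Measure.ext_of_charFun ?_
    funext t
    rw [← complexMGF_id_mul_I, ← complexMGF_id_mul_I]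
    exact heq (by simp)
  have := congrArg (fun ρ => expTilt ρ (-(z₀ + 1))) key
  simpa only [expTilt_expTilt, add_neg_cancel, expTilt_zero] using this

/-- Chernoff bound: `e^{z (t - x)} ≥ 1` for `x ≤ t`. It yields local finiteness, the absence of an
atom of `U` at `0`, and the smallness of `U` on short intervals. -/
lemma measure_Iic_le_laplace (μ : Measure ℝ) {z : ℝ} (hz : 0 ≤ z) (t : ℝ) :
    μ (Iic t) ≤ ENNReal.ofReal (Real.exp (z * t)) * laplace μ z := by
  unfold laplace
  rw [← lintegral_const_mul _ (by fun_prop), ← lintegral_indicator_one measurableSet_Iic]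
  refine lintegral_mono fun x => ?_
  by_cases hx : x ∈ Iic t
  · simp only [hx, indicator_of_mem, Pi.one_apply]
    rw [← ENNReal.ofReal_mul (by positivity), ← Real.exp_add]
    refine ENNReal.one_le_ofReal.2 (Real.one_le_exp ?_)
    have : z * x ≤ z * t := mul_le_mul_of_nonneg_left hx hz
    linarith
  · simp [hx]

lemma lintegral_exp_neg_mul_Ici {a : ℝ} (ha : 0 < a) :
    ∫⁻ s in Ici (0 : ℝ), ENNReal.ofReal (Real.exp (-(a * s))) = ENNReal.ofReal a⁻¹ := by
  rw [setLIntegral_congr Ioi_ae_eq_Ici.symm, ← ofReal_integral_eq_lintegral_ofReal]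
  · have := integral_exp_mul_Ioi (neg_lt_zero.2 ha) 0
    simp only [neg_mul, mul_zero, Real.exp_zero] at this
    rw [this, neg_div_neg_eq, one_div]
  · have := integrableOn_exp_mul_Ioi (neg_lt_zero.2 ha) 0
    simp only [neg_mul] at this
    exact this
  · exact Eventually.of_forall fun x => by positivity

lemma laplace_volume {z : ℝ} (hz : 0 < z) :
    laplace (volume.restrict (Ici (0 : ℝ))) z = ENNReal.ofReal z⁻¹ :=
  lintegral_exp_neg_mul_Ici hz

/-! ### The Laplace exponent and the tail of the Lévy measure. -/

namespace IsLevyTriple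

variable {Φ : ℝ → ℝ} {ν : Measure ℝ}

lemma measure_Ioi_lt_top {a b : ℝ} (h : IsLevyTriple Φ a b ν) {ε : ℝ} (hε : 0 < ε) :
    ν (Ioi ε) < ∞ := by
  have h1 : ENNReal.ofReal (min 1 ε) * ν (Ioi ε) ≤
      ∫⁻ x in Ioi (0 : ℝ), ENNReal.ofReal (min 1 x) ∂ν := by
    rw [← setLIntegral_const]
    refine (setLIntegral_mono (by fun_prop) fun x (hx : ε < x) => ?_).trans
      (lintegral_mono_set (Ioi_subset_Ioi hε.le))
    gcongr
  have h2 := h1.trans_lt h.lintegral_lt_top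
  by_contra h3
  rw [not_lt, top_le_iff] at h3
  rw [h3, ENNReal.mul_top (by simp [hε])] at h2
  exact lt_irrefl _ h2

lemma integrable_one_sub_exp {a b : ℝ} (h : IsLevyTriple Φ a b ν) {z : ℝ} (hz : 0 < z) :
    Integrable (fun x => 1 - Real.exp (-(z * x))) (ν.restrict (Ioi 0)) := by
  have h1 : Integrable (fun x : ℝ => max 1 z * min 1 x) (ν.restrict (Ioi 0)) := by
    refine Integrable.const_mul ⟨by fun_prop, ?_⟩ _
    rw [hasFiniteIntegral_iff_ofReal]
    · exact h.lintegral_lt_top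
    · filter_upwards [ae_restrict_mem measurableSet_Ioi] with x (hx : 0 < x)
      show 0 ≤ min 1 x
      positivity
  refine h1.mono' (by fun_prop) ?_
  filter_upwards [ae_restrict_mem measurableSet_Ioi] with x (hx : 0 < x)
  have h2 : Real.exp (-(z * x)) ≤ 1 := Real.exp_le_one_iff.2 (by nlinarith)
  have h3 := Real.add_one_le_exp (-(z * x))
  have h4 := Real.exp_pos (-(z * x))
  rw [Real.norm_of_nonneg (by linarith)]
  rcases le_total 1 x with h5 | h5
  · rw [min_eq_left h5]; linarith [le_max_left 1 z]
  · rw [min_eq_right h5]; nlinarith [le_max_right 1 z]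

lemma lintegral_one_sub_exp (h : IsLevyTriple Φ 0 0 ν) {z : ℝ} (hz : 0 < z) :
    ∫⁻ x in Ioi (0 : ℝ), ENNReal.ofReal (1 - Real.exp (-(z * x))) ∂ν = ENNReal.ofReal (Φ z) := by
  rw [h.eq z hz, zero_mul, zero_add, zero_add,
    ofReal_integral_eq_lintegral_ofReal (h.integrable_one_sub_exp hz)]
  filter_upwards [ae_restrict_mem measurableSet_Ioi] with x (hx : 0 < x)
  have h2 : Real.exp (-(z * x)) ≤ 1 := Real.exp_le_one_iff.2 (by nlinarith)
  simp only [Pi.zero_apply]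
  linarith

lemma monotoneOn (h : IsLevyTriple Φ 0 0 ν) : MonotoneOn Φ (Ioi 0) := by
  intro z hz w hw hzw
  rw [h.eq z hz, h.eq w hw]
  simp only [zero_mul, zero_add]
  refine setIntegral_mono_on (h.integrable_one_sub_exp hz) (h.integrable_one_sub_exp hw)
    measurableSet_Ioi fun x (hx : 0 < x) => ?_
  gcongr

/-- If the Lévy measure is infinite, then the Bernstein function is unbounded. -/
lemma tendsto_atTop (h : IsLevyTriple Φ 0 0 ν) (htop : ν (Ioi 0) = ∞) :
    Tendsto Φ atTop atTop := by
  refine Filter.tendsto_atTop.2 fun M => ?_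
  have hU : Tendsto (fun n : ℕ => ν (Ioi (1 / ((n : ℝ) + 1)))) atTop (𝓝 (ν (Ioi 0))) := by
    have : Ioi (0 : ℝ) = ⋃ n : ℕ, Ioi (1 / ((n : ℝ) + 1)) := by
      ext x
      simp only [mem_Ioi, mem_iUnion]
      exact ⟨fun hx => exists_nat_one_div_lt hx, fun ⟨n, hn⟩ => lt_trans (by positivity) hn⟩
    rw [this]
    refine tendsto_measure_iUnion_atTop fun m n hmn => Ioi_subset_Ioi ?_
    gcongr
  rw [htop] at hU
  have hev := hU.eventually (lt_mem_nhds (ENNReal.ofReal_lt_top (r := 2 * |M|)))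
  obtain ⟨n, hn⟩ := hev.exists
  filter_upwards [eventually_ge_atTop ((n : ℝ) + 1)] with z hz
  have hz0 : (0 : ℝ) < n + 1 := by positivity
  refine le_trans ?_ (h.monotoneOn (mem_Ioi.2 hz0) (mem_Ioi.2 (hz0.trans_le hz)) hz)
  -- For `x > 1/(n+1)` the integrand defining `Φ(n+1)` exceeds `1 - e^{-1} ≥ 1/2`.
  have h1 : ENNReal.ofReal (1 / 2) * ν (Ioi (1 / ((n : ℝ) + 1))) ≤
      ENNReal.ofReal (Φ (n + 1)) := by
    rw [← h.lintegral_one_sub_exp hz0, ← setLIntegral_const]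
    refine (setLIntegral_mono (by fun_prop) fun x hx => ?_).trans
      (lintegral_mono_set (Ioi_subset_Ioi (by positivity)))
    have hx' : 1 < (n + 1) * x := by
      rw [mem_Ioi, div_lt_iff₀ hz0] at hx; linarith
    have h3 : Real.exp (-((n + 1) * x)) ≤ Real.exp (-1) := by gcongr
    have h4 : Real.exp (-1) ≤ 1 / 2 := by
      have := Real.add_one_le_exp (1 : ℝ)
      rw [Real.exp_neg, one_div]
      gcongr
      linarith
    gcongr
    linarith
  have h2 : ENNReal.ofReal |M| ≤ ENNReal.ofReal (Φ (n + 1)) := by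
    refine le_trans ?_ h1
    have : ENNReal.ofReal |M| = ENNReal.ofReal (1 / 2) * ENNReal.ofReal (2 * |M|) := by
      rw [← ENNReal.ofReal_mul (by norm_num)]; congr 1; ring
    rw [this]
    gcongr
  rcases le_or_gt (Φ (n + 1)) 0 with h5 | h5
  · rw [ENNReal.ofReal_of_nonpos h5, nonpos_iff_eq_zero, ENNReal.ofReal_eq_zero] at h2
    have h6 : M ≤ 0 := (le_abs_self M).trans h2
    rw [h.eq _ hz0, zero_mul, zero_add, zero_add]
    refine h6.trans (setIntegral_nonneg measurableSet_Ioi fun x (hx : 0 < x) => ?_)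
    have : Real.exp (-((n + 1) * x)) ≤ 1 := Real.exp_le_one_iff.2 (by nlinarith)
    linarith
  · exact (le_abs_self M).trans ((ENNReal.ofReal_le_ofReal_iff h5.le).1 h2)

/-- The measure on `(0, ∞)` whose density is the tail of the Lévy measure. -/
noncomputable def _root_.tailMeasure (ν : Measure ℝ) : Measure ℝ :=
  (volume.restrict (Ioi 0)).withDensity fun t => ν (Ioi t)

lemma _root_.measurable_measure_Ioi (ν : Measure ℝ) : Measurable fun t : ℝ => ν (Ioi t) :=
  Antitone.measurable fun _ _ h => measure_mono (Ioi_subset_Ioi h)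

/-- Layer-cake formula: integrating `e^{-z t}` over `t < x` and then over `ν(dx)` gives `z⁻¹ ∫ (1 -
e^{-z x}) ν(dx)`. -/
lemma laplace_tailMeasure (h : IsLevyTriple Φ 0 0 ν) {z : ℝ} (hz : 0 < z) :
    laplace (tailMeasure ν) z = ENNReal.ofReal (Φ z / z) := by
  unfold laplace tailMeasure
  rw [lintegral_withDensity_eq_lintegral_mul _ (measurable_measure_Ioi ν) (by fun_prop)]
  have hlc := lintegral_comp_eq_lintegral_meas_lt_mul (ν.restrict (Ioi 0)) (f := id)
    (g := fun t => Real.exp (-(z * t)))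
    (by filter_upwards [ae_restrict_mem measurableSet_Ioi] with x (hx : 0 < x) using hx.le)
    aemeasurable_id (fun t _ => (by fun_prop : Continuous fun t => Real.exp (-(z * t))).intervalIntegrable _ _)
    (Eventually.of_forall fun t => by positivity)
  have h1 : ∫⁻ t in Ioi (0 : ℝ), ((fun t => ν (Ioi t)) * fun x => ENNReal.ofReal (Real.exp (-(z * x)))) t =
      ∫⁻ t in Ioi (0 : ℝ), ν.restrict (Ioi 0) {a | t < id a} * ENNReal.ofReal (Real.exp (-(z * t))) := by
    refine setLIntegral_congr_fun measurableSet_Ioi fun t (ht : 0 < t) => ?_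
    simp only [Pi.mul_apply, id]
    congr 1
    change ν (Ioi t) = ν.restrict (Ioi 0) (Ioi t)
    rw [Measure.restrict_apply measurableSet_Ioi]
    congr 1
    ext x
    simp only [mem_Ioi, mem_inter_iff]
    exact ⟨fun h => ⟨h, ht.trans h⟩, fun h => h.1⟩
  rw [h1, ← hlc]
  have h2 : ∀ x : ℝ, ∫ t in (0 : ℝ)..id x, Real.exp (-(z * t)) = z⁻¹ * (1 - Real.exp (-(z * x))) := by
    intro x
    have h3 : ∀ t ∈ uIcc 0 x, HasDerivAt (fun t => z⁻¹ * (1 - Real.exp (-(z * t))))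
        (Real.exp (-(z * t))) t := by
      intro t _
      have h4 : HasDerivAt (fun t : ℝ => -(z * t)) (-z) t := by
        convert! ((hasDerivAt_id t).const_mul z).neg using 1
        simp
      have h5 := (h4.exp.const_sub 1).const_mul z⁻¹
      convert! h5 using 1
      field_simp
    simp only [id]
    rw [intervalIntegral.integral_eq_sub_of_hasDerivAt h3
      ((by fun_prop : Continuous fun t => Real.exp (-(z * t))).intervalIntegrable _ _)]
    simp
  simp_rw [h2, ENNReal.ofReal_mul (inv_nonneg.2 hz.le)]
  rw [lintegral_const_mul _ (by fun_prop), h.lintegral_one_sub_exp hz,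
    ← ENNReal.ofReal_mul (inv_nonneg.2 hz.le)]
  congr 1
  field_simp

end IsLevyTriple

lemma IsSpecialBernstein.pos {Φ : ℝ → ℝ} (h : IsSpecialBernstein Φ) {z : ℝ} (hz : 0 < z) :
    0 < Φ z :=
  lt_of_le_of_ne (h.isBernstein.nonneg z hz) (h.ne_zero z hz).symm

/-! ### Weighted potential measures and the inverse subordinator. -/

/-- The exponentially weighted potential measure `A ↦ E ∫_0^∞ e^{l s} 1_A(σ(s)) ds`. -/
noncomputable def expPotential {Ω : Type*} [MeasurableSpace Ω] (P : Measure Ω)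
    (σ : ℝ≥0 → Ω → ℝ) (l : ℝ) : Measure ℝ :=
  (P.prod ((volume.restrict (Ici (0 : ℝ))).withDensity
    fun s => ENNReal.ofReal (Real.exp (l * s)))).map (fun p : Ω × ℝ => σ p.2.toNNReal p.1)

section

variable {Ω : Type*} [MeasurableSpace Ω] {P : Measure Ω} {σ : ℝ≥0 → Ω → ℝ} {Φ : ℝ → ℝ}

lemma expPotential_zero : expPotential P σ 0 = potentialMeasure P σ := by
  simp [expPotential, potentialMeasure]

namespace IsSubordinator

lemma ae_nonneg (hσ : IsSubordinator P σ) : ∀ᵐ ω ∂P, ∀ s, 0 ≤ σ s ω := by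
  filter_upwards [hσ.zero, hσ.monotone] with ω h0 h1 s
  exact h0.symm.le.trans (h1 (zero_le (a := s)))

lemma measurable_comp_nat (hσ : IsSubordinator P σ) (τ : ℕ → ℝ≥0) {k : ℝ → ℕ} (hk : Measurable k) :
    Measurable fun p : Ω × ℝ => σ (τ (k p.2)) p.1 := by
  have h1 : Measurable (fun q : Ω × ℕ => σ (τ q.2) q.1) :=
    measurable_from_prod_countable_left fun k => hσ.measurable (τ k)
  exact h1.comp (measurable_fst.prodMk (hk.comp measurable_snd))

/-- Joint measurability comes from right-continuity: paths are sampled at grid times decreasing to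
`s`. It is what permits Tonelli in `(ω, s)`. -/
lemma aemeasurable_uncurry [SFinite P] (hσ : IsSubordinator P σ) (ρ : Measure ℝ) [SFinite ρ] :
    AEMeasurable (fun p : Ω × ℝ => σ p.2.toNNReal p.1) (P.prod ρ) := by
  refine aemeasurable_of_tendsto_metrizable_ae' (f := fun (n : ℕ) (p : Ω × ℝ) =>
    -- The `+ 1` in the numerator keeps the grid point to the right of `s`; the one in the
    -- denominator avoids `n = 0`.
    σ (((⌊((n : ℝ≥0) + 1) * p.2.toNNReal⌋₊ : ℝ≥0) + 1) / ((n : ℝ≥0) + 1)) p.1)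
    (fun n => Measurable.aemeasurable ?_) ?_
  · refine hσ.measurable_comp_nat (fun k => ((k : ℝ≥0) + 1) / ((n : ℝ≥0) + 1))
      (k := fun s => ⌊((n : ℝ≥0) + 1) * s.toNNReal⌋₊) ?_
    exact Nat.measurable_floor.comp (by fun_prop)
  · filter_upwards [Measure.quasiMeasurePreserving_fst.ae hσ.rightCont] with p hp
    have hs : Tendsto (fun n : ℕ => ((⌊((n : ℝ≥0) + 1) * p.2.toNNReal⌋₊ : ℝ≥0) + 1) /
        ((n : ℝ≥0) + 1)) atTop (𝓝[≥] p.2.toNNReal) := by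
      refine tendsto_nhdsWithin_iff.2 ⟨?_, Eventually.of_forall fun n => ?_⟩
      · set s := p.2.toNNReal
        have h3 : Tendsto (fun n : ℕ => s + 1 / ((n : ℝ≥0) + 1)) atTop (𝓝 (s + 0)) :=
          tendsto_const_nhds.add (NNReal.tendsto_coe.1 (by
            simpa using tendsto_one_div_add_atTop_nhds_zero_nat (𝕜 := ℝ)))
        rw [add_zero] at h3
        refine tendsto_of_tendsto_of_tendsto_of_le_of_le tendsto_const_nhds h3 (fun n => ?_)
          fun n => ?_
        · show s ≤ _
          rw [le_div_iff₀ (by positivity), mul_comm]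
          exact (Nat.lt_floor_add_one _).le
        · show _ ≤ s + 1 / ((n : ℝ≥0) + 1)
          rw [div_le_iff₀ (by positivity), add_mul _ _ ((n : ℝ≥0) + 1), one_div,
            inv_mul_cancel₀ (by positivity), mul_comm s]
          gcongr
          exact Nat.floor_le (by positivity)
      · rw [mem_Ici, le_div_iff₀ (by positivity), mul_comm]
        exact (Nat.lt_floor_add_one _).le
    exact (hp p.2.toNNReal).tendsto.comp hs

lemma lintegral_exp [IsProbabilityMeasure P] (hσΦ : HasLaplaceExponent P σ Φ) (s : ℝ≥0) {z : ℝ}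
    (hz : 0 < z) :
    ∫⁻ ω, ENNReal.ofReal (Real.exp (-(z * σ s ω))) ∂P =
      ENNReal.ofReal (Real.exp (-((s : ℝ) * Φ z))) := by
  rw [← hσΦ s z hz, ofReal_integral_eq_lintegral_ofReal]
  -- A non-integrable function would have Bochner integral `0`, whereas the exponential on the right
  -- is positive.
  · by_contra h
    have := hσΦ s z hz
    rw [integral_undef h] at this
    exact (Real.exp_pos _).ne this
  · exact Eventually.of_forall fun x => by positivity

variable [IsProbabilityMeasure P]

lemma lintegral_expPotential (hσ : IsSubordinator P σ) (l : ℝ) {f : ℝ → ℝ≥0∞} (hf : Measurable f) :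
    ∫⁻ x, f x ∂(expPotential P σ l) = ∫⁻ s in Ici (0 : ℝ), ENNReal.ofReal (Real.exp (l * s)) *
      ∫⁻ ω, f (σ s.toNNReal ω) ∂P := by
  have hm := hσ.aemeasurable_uncurry ((volume.restrict (Ici (0 : ℝ))).withDensity
    fun s => ENNReal.ofReal (Real.exp (l * s)))
  unfold expPotential
  rw [lintegral_map' hf.aemeasurable hm, lintegral_prod_symm (fun p : Ω × ℝ => f (σ p.2.toNNReal p.1)) (hf.comp_aemeasurable hm)]
  rw [lintegral_withDensity_eq_lintegral_mul₀ (by fun_prop)]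
  · rfl
  · exact (hf.comp_aemeasurable (hσ.aemeasurable_uncurry _)).lintegral_prod_left'

lemma laplace_expPotential (hσ : IsSubordinator P σ) (hσΦ : HasLaplaceExponent P σ Φ) {l z : ℝ}
    (hz : 0 < z) (hl : l < Φ z) :
    laplace (expPotential P σ l) z = ENNReal.ofReal (Φ z - l)⁻¹ := by
  unfold laplace
  rw [hσ.lintegral_expPotential l (by fun_prop), ← lintegral_exp_neg_mul_Ici (sub_pos.2 hl)]
  refine setLIntegral_congr_fun measurableSet_Ici fun s (hs : 0 ≤ s) => ?_
  rw [lintegral_exp hσΦ _ hz, ← ENNReal.ofReal_mul (by positivity), ← Real.exp_add,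
    Real.coe_toNNReal _ hs]
  ring_nf

lemma expPotential_Iio (hσ : IsSubordinator P σ) (l : ℝ) : expPotential P σ l (Iio 0) = 0 := by
  rw [← lintegral_indicator_one measurableSet_Iio,
    hσ.lintegral_expPotential l (measurable_one.indicator measurableSet_Iio)]
  refine (lintegral_congr fun s => ?_).trans lintegral_zero
  have : ∫⁻ ω, (Iio (0 : ℝ)).indicator (1 : ℝ → ℝ≥0∞) (σ s.toNNReal ω) ∂P = 0 := by
    refine lintegral_eq_zero_of_ae_eq_zero ?_
    filter_upwards [hσ.ae_nonneg] with ω hω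
    simp [hω s.toNNReal]
  rw [this, mul_zero]

/-- By Chernoff, `P(σ(n+1) ≤ k) ≤ e^{k - (n+1) Φ(1)} → 0`. Hence the set whose infimum defines the
inverse is a.s. nonempty, and `sInf` does not take its default value `0`. -/
lemma ae_exists_lt (hσ : IsSubordinator P σ) (hσΦ : HasLaplaceExponent P σ Φ) (hΦ : 0 < Φ 1) :
    ∀ᵐ ω ∂P, ∀ t : ℝ, ∃ y : ℝ≥0, 0 < y ∧ t < σ y ω := by
  have key : ∀ k : ℕ, ∀ᵐ ω ∂P, ∃ n : ℕ, (k : ℝ) < σ ((n : ℝ≥0) + 1) ω := by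
    intro k
    rw [ae_iff]
    have hb : ∀ n : ℕ, P {ω | ¬ ∃ n : ℕ, (k : ℝ) < σ ((n : ℝ≥0) + 1) ω} ≤
        ENNReal.ofReal (Real.exp (k - (n + 1) * Φ 1)) := by
      intro n
      have h1 : ENNReal.ofReal (Real.exp (k - (n + 1) * Φ 1)) =
          ENNReal.ofReal (Real.exp k) *
            ∫⁻ ω, ENNReal.ofReal (Real.exp (-(1 * σ ((n : ℝ≥0) + 1) ω))) ∂P := by
        rw [lintegral_exp hσΦ _ one_pos, ← ENNReal.ofReal_mul (by positivity), ← Real.exp_add]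
        congr 2
      rw [h1, ← lintegral_const_mul' _ _ ENNReal.ofReal_ne_top]
      refine meas_le_lintegral₀ ?_ fun ω hω => ?_
      · have := (hσ.measurable ((n : ℝ≥0) + 1)).aemeasurable (μ := P)
        fun_prop
      · have h2 : σ ((n : ℝ≥0) + 1) ω ≤ k := not_lt.1 fun h => hω ⟨n, h⟩
        rw [← ENNReal.ofReal_mul (by positivity), ← Real.exp_add]
        exact ENNReal.one_le_ofReal.2 (Real.one_le_exp (by linarith))
    have hlim : Tendsto (fun n : ℕ => ENNReal.ofReal (Real.exp (k - (n + 1) * Φ 1))) atTop (𝓝 0) := by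
      rw [← ENNReal.ofReal_zero]
      refine ENNReal.tendsto_ofReal (Real.tendsto_exp_atBot.comp ?_)
      refine tendsto_atBot_add_const_left _ (k : ℝ) (f := fun n : ℕ => -((n + 1) * Φ 1)) ?_
      refine tendsto_neg_atTop_atBot.comp (Tendsto.atTop_mul_const hΦ ?_)
      exact tendsto_atTop_add_const_right _ _ tendsto_natCast_atTop_atTop
    exact le_antisymm (ge_of_tendsto' hlim hb) zero_le
  filter_upwards [ae_all_iff.2 key] with ω hω t
  obtain ⟨k, hk⟩ := exists_nat_ge t
  obtain ⟨n, hn⟩ := hω k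
  exact ⟨n + 1, by positivity, hk.trans_lt hn⟩

/-- Almost surely, `e^{l L(t)} = 1 + l ∫ e^{l y} 1_{σ(y) ≤ t} dy`. -/
lemma ae_exp_inverseSubordinator (hσ : IsSubordinator P σ) (hσΦ : HasLaplaceExponent P σ Φ)
    (hΦ : 0 < Φ 1) {l : ℝ} (hl : 0 < l) (t : ℝ) :
    ∀ᵐ ω ∂P, ENNReal.ofReal (Real.exp (l * inverseSubordinator σ t ω)) =
      1 + ENNReal.ofReal l * ∫⁻ s in Ici (0 : ℝ), ENNReal.ofReal (Real.exp (l * s)) *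
        (Iic t).indicator 1 (σ s.toNNReal ω) := by
  filter_upwards [hσ.monotone, hσ.ae_exists_lt hσΦ hΦ] with ω hmono hex
  set y := inverseSubordinator σ t ω with hy
  -- By monotonicity of the path, `{s : σ(s) ≤ t}` is the interval from `0` to `L(t)` up to its
  -- endpoints, which are Lebesgue-null.
  have hlt : ∀ s : ℝ≥0, 0 < s → s < y → σ s ω ≤ t := by
    intro s hs hsy
    by_contra hcon
    exact (not_le.2 hsy) (csInf_le (OrderBot.bddBelow _) ⟨hs, not_le.1 hcon⟩)
  have hgt : ∀ s : ℝ≥0, y < s → t < σ s ω := by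
    intro s hsy
    obtain ⟨r, hr, hrs⟩ := exists_lt_of_csInf_lt (hex t) hsy
    exact hr.2.trans_le (hmono hrs.le)
  have h1 : ∫⁻ s in Ici (0 : ℝ), ENNReal.ofReal (Real.exp (l * s)) *
        (Iic t).indicator 1 (σ s.toNNReal ω) =
      ∫⁻ s in Ioc (0 : ℝ) y, ENNReal.ofReal (Real.exp (l * s)) := by
    rw [← lintegral_indicator measurableSet_Ici, ← lintegral_indicator measurableSet_Ioc]
    refine lintegral_congr_ae ?_
    have e1 : ∀ᵐ s : ℝ, s ≠ 0 := by simp [ae_iff]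
    have e2 : ∀ᵐ s : ℝ, s ≠ y := by simp [ae_iff]
    filter_upwards [e1, e2] with s hs0 hsy
    rcases lt_or_gt_of_ne hs0 with hs | hs
    · rw [indicator_of_notMem (by simpa using hs), indicator_of_notMem (by simp [hs.le])]
    rw [indicator_of_mem (by simpa using hs.le)]
    rcases lt_or_gt_of_ne hsy with hsy | hsy
    · have : σ s.toNNReal ω ≤ t := hlt _ (Real.toNNReal_pos.2 hs) (by
        rw [Real.toNNReal_lt_iff_lt_coe hs.le]; exact hsy)
      rw [indicator_of_mem (s := Ioc (0 : ℝ) y) (a := s) ⟨hs, hsy.le⟩, indicator_of_mem (by simpa using this)]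
      simp
    · have : t < σ s.toNNReal ω := hgt _ (by
        rw [Real.lt_toNNReal_iff_coe_lt]; exact hsy)
      rw [indicator_of_notMem (a := s) (by simp [hsy]), indicator_of_notMem (by simpa using this)]
      simp
  have h2 : ∫⁻ s in Ioc (0 : ℝ) y, ENNReal.ofReal (Real.exp (l * s)) =
      ENNReal.ofReal ((Real.exp (l * y) - 1) / l) := by
    rw [← ofReal_integral_eq_lintegral_ofReal, ← intervalIntegral.integral_of_le (by positivity)]
    · congr 1
      have := intervalIntegral.integral_comp_mul_left (a := 0) (b := (y : ℝ)) (fun x => Real.exp x) hl.ne'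
      rw [this]
      simp [div_eq_inv_mul]
    · exact (by fun_prop : Continuous fun s => Real.exp (l * s)).integrableOn_Ioc
    · exact Eventually.of_forall fun s => by positivity
  have h3 : (1 : ℝ) ≤ Real.exp (l * y) := Real.one_le_exp (by positivity)
  rw [h1, h2, ← ENNReal.ofReal_mul hl.le, ← ENNReal.ofReal_one,
    ← ENNReal.ofReal_add zero_le_one (mul_nonneg hl.le (div_nonneg (by linarith) hl.le))]
  congr 1
  field_simp
  ring

/-- The inverse is an infimum over an uncountable set; its measurability is read off the integral
formula, where only the jointly measurable process occurs. -/
lemma aemeasurable_exp_inverseSubordinator (hσ : IsSubordinator P σ)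
    (hσΦ : HasLaplaceExponent P σ Φ) (hΦ : 0 < Φ 1) {l : ℝ} (hl : 0 < l) (t : ℝ) :
    AEMeasurable (fun ω => Real.exp (l * inverseSubordinator σ t ω)) P := by
  have h1 : AEMeasurable (fun ω => ENNReal.ofReal (Real.exp (l * inverseSubordinator σ t ω))) P := by
    refine AEMeasurable.congr ?_ (Filter.EventuallyEq.symm (hσ.ae_exp_inverseSubordinator hσΦ hΦ hl t))
    refine (AEMeasurable.const_mul ?_ _).const_add _
    refine AEMeasurable.lintegral_prod_right' (f := fun p : Ω × ℝ =>
      ENNReal.ofReal (Real.exp (l * p.2)) * (Iic t).indicator 1 (σ p.2.toNNReal p.1)) ?_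
    refine AEMeasurable.mul (by fun_prop) ?_
    exact (measurable_one.indicator measurableSet_Iic).comp_aemeasurable
      (hσ.aemeasurable_uncurry _)
  refine h1.ennreal_toReal.congr (Eventually.of_forall fun ω => ?_)
  exact ENNReal.toReal_ofReal (by positivity)

lemma lintegral_exp_inverseSubordinator (hσ : IsSubordinator P σ)
    (hσΦ : HasLaplaceExponent P σ Φ) (hΦ : 0 < Φ 1) {l : ℝ} (hl : 0 < l) (t : ℝ) :
    ∫⁻ ω, ENNReal.ofReal (Real.exp (l * inverseSubordinator σ t ω)) ∂P =
      1 + ENNReal.ofReal l * expPotential P σ l (Iic t) := by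
  have hm : AEMeasurable (fun p : Ω × ℝ =>
      ENNReal.ofReal (Real.exp (l * p.2)) * (Iic t).indicator (1 : ℝ → ℝ≥0∞) (σ p.2.toNNReal p.1))
      (P.prod (volume.restrict (Ici 0))) :=
    AEMeasurable.mul (by fun_prop) ((measurable_one.indicator measurableSet_Iic).comp_aemeasurable
      (hσ.aemeasurable_uncurry _))
  rw [lintegral_congr_ae (hσ.ae_exp_inverseSubordinator hσΦ hΦ hl t),
    lintegral_add_left measurable_const, lintegral_const_mul' _ _ ENNReal.ofReal_ne_top,
    ← lintegral_indicator_one measurableSet_Iic,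
    hσ.lintegral_expPotential l (measurable_one.indicator measurableSet_Iic)]
  simp only [lintegral_const, measure_univ, mul_one]
  congr 2
  rw [lintegral_lintegral_swap hm]
  refine lintegral_congr fun s => ?_
  rw [lintegral_const_mul' _ _ ENNReal.ofReal_ne_top]

end IsSubordinator

end

/-! ### Derivatives of Laplace transforms and Post-Widder monotonicity. -/

/-- The weighted Laplace transform `∫ x^n e^{-z x} U(dx)`. -/
noncomputable def laplaceMoment (U : Measure ℝ) (n : ℕ) (z : ℝ) : ℝ :=
  ∫ x, x ^ n * Real.exp (-(z * x)) ∂U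

section

variable {U : Measure ℝ}

/-- With `-x` as the random variable, `∫ e^{-z x} dU` is a moment generating function, so
differentiation under the integral is available for every `z > 0`. -/
lemma mem_interior_integrableExpSet_neg (hfin : ∀ z, 0 < z → laplace U z < ∞) {z : ℝ} (hz : 0 < z) :
    z ∈ interior (integrableExpSet (fun x => -x) U) := by
  have : Ioi (0 : ℝ) ⊆ interior (integrableExpSet (fun x => -x) U) := by
    refine interior_maximal (fun w hw => ?_) isOpen_Ioi
    refine ⟨by fun_prop, ?_⟩
    rw [hasFiniteIntegral_iff_ofReal (Eventually.of_forall fun x => by positivity)]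
    simpa [laplace] using hfin w hw
  exact this hz

lemma integrable_pow_mul_exp_neg (hfin : ∀ z, 0 < z → laplace U z < ∞) (n : ℕ) {z : ℝ}
    (hz : 0 < z) : Integrable (fun x => x ^ n * Real.exp (-(z * x))) U := by
  have h := integrable_pow_mul_exp_of_mem_interior_integrableExpSet
    (mem_interior_integrableExpSet_neg hfin hz) n
  refine (h.const_mul ((-1) ^ n)).congr (Eventually.of_forall fun x => ?_)
  simp only [mul_neg]
  rw [← mul_assoc, ← mul_pow]
  simp

lemma hasDerivAt_laplaceMoment (hfin : ∀ z, 0 < z → laplace U z < ∞) (n : ℕ) {z : ℝ} (hz : 0 < z) :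
    HasDerivAt (laplaceMoment U n) (-(laplaceMoment U (n + 1) z)) z := by
  have h := (hasDerivAt_integral_pow_mul_exp_real
    (mem_interior_integrableExpSet_neg hfin hz) n).const_mul ((-1) ^ n)
  have e : ∀ (m : ℕ) (w : ℝ), laplaceMoment U m w = (-1) ^ m * ∫ x, (-x) ^ m * Real.exp (w * -x) ∂U := by
    intro m w
    rw [← integral_const_mul]
    refine integral_congr_ae (Eventually.of_forall fun x => ?_)
    simp only [mul_neg]
    rw [← mul_assoc, ← mul_pow]
    simp
  convert! h using 1
  · exact funext fun w => e n w
  · rw [e, pow_succ]; ring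

lemma laplace_eq_laplaceMoment (U : Measure ℝ) (z : ℝ) : (laplace U z).toReal = laplaceMoment U 0 z := by
  unfold laplace laplaceMoment
  rw [integral_eq_lintegral_of_nonneg_ae (Eventually.of_forall fun x => by positivity) (by fun_prop)]
  simp

lemma iteratedDeriv_mul_laplace (hfin : ∀ z, 0 < z → laplace U z < ∞) (n : ℕ) :
    ∀ z : ℝ, 0 < z → iteratedDeriv (n + 1) (fun z => z * (laplace U z).toReal) z =
      (-1) ^ (n + 1) * (z * laplaceMoment U (n + 1) z - (n + 1) * laplaceMoment U n z) := by
  simp_rw [laplace_eq_laplaceMoment]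
  induction n with
  | zero =>
    intro z hz
    rw [zero_add, iteratedDeriv_one]
    have h := ((hasDerivAt_id z).mul (hasDerivAt_laplaceMoment hfin 0 hz)).deriv
    simp only [id] at h
    refine Eq.trans h ?_
    simp [sub_eq_add_neg]
  | succ n ih =>
    intro z hz
    rw [iteratedDeriv_succ]
    have hev : iteratedDeriv (n + 1) (fun z => z * laplaceMoment U 0 z) =ᶠ[𝓝 z]
        fun z => (-1) ^ (n + 1) * (z * laplaceMoment U (n + 1) z - (n + 1) * laplaceMoment U n z) := by
      filter_upwards [Ioi_mem_nhds hz] with w hw using ih w hw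
    rw [hev.deriv_eq]
    have h1 := (hasDerivAt_id z).mul (hasDerivAt_laplaceMoment hfin (n + 1) hz)
    have h2 := (hasDerivAt_laplaceMoment hfin n hz).const_mul ((n : ℝ) + 1)
    have h3 := ((h1.sub h2).const_mul ((-1 : ℝ) ^ (n + 1))).deriv
    refine Eq.trans h3 ?_
    simp only [id]
    push_cast
    ring

/-- The Post-Widder approximants of a measure whose Laplace transform `L` is such that `z L(z)` is
a Bernstein function are monotone. -/
lemma monotoneOn_pow_mul_laplaceMoment (hfin : ∀ z, 0 < z → laplace U z < ∞)
    (hder : ∀ n : ℕ, 1 ≤ n → ∀ z : ℝ, 0 < z →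
      (-1 : ℝ) ^ n * iteratedDeriv n (fun z => z * (laplace U z).toReal) z ≤ 0) (n : ℕ) :
    MonotoneOn (fun z => z ^ (n + 1) * laplaceMoment U n z) (Ioi 0) := by
  have hd : ∀ z : ℝ, 0 < z → HasDerivAt (fun z => z ^ (n + 1) * laplaceMoment U n z)
      (((n + 1 : ℕ) : ℝ) * z ^ n * laplaceMoment U n z +
        z ^ (n + 1) * (-laplaceMoment U (n + 1) z)) z := fun z hz => by
    have h := (hasDerivAt_pow (n + 1) z).mul (hasDerivAt_laplaceMoment hfin n hz)
    exact h
  refine monotoneOn_of_deriv_nonneg (convex_Ioi 0)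
    (fun z hz => (hd z hz).continuousAt.continuousWithinAt)
    (fun z hz => ?_) fun z hz => ?_
  · rw [interior_Ioi] at hz
    exact (hd z hz).differentiableAt.differentiableWithinAt
  · rw [interior_Ioi] at hz
    have hz : 0 < z := hz
    rw [(hd z hz).deriv]
    -- The derivative is `z^n ((n+1) M_n(z) - z M_{n+1}(z))`, with `M_n` the weighted transforms;
    -- its sign is the Bernstein inequality of order `n + 1` for `z ↦ z L(z)`.
    have h := hder (n + 1) (by simp) z hz
    rw [iteratedDeriv_mul_laplace hfin n z hz, ← mul_assoc, ← mul_pow] at h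
    simp only [mul_neg, mul_one, neg_neg, one_pow, one_mul, tsub_le_iff_right, zero_add] at h
    have h2 : 0 ≤ z ^ n * ((n + 1) * laplaceMoment U n z - z * laplaceMoment U (n + 1) z) :=
      mul_nonneg (by positivity) (by linarith)
    push_cast
    rw [pow_succ]
    linarith

end

/-! ### The Gamma kernel: tails and concentration. -/

lemma integral_pow_mul_exp_neg (n : ℕ) {c : ℝ} (hc : 0 < c) :
    Integrable (fun s : ℝ => s ^ n * Real.exp (-(c * s))) (volume.restrict (Ioi 0)) ∧
    ∫ s in Ioi (0 : ℝ), s ^ n * Real.exp (-(c * s)) = n.factorial / c ^ (n + 1) := by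
  have h := Real.integral_rpow_mul_exp_neg_mul_Ioi (a := n + 1) (r := c) (by positivity) hc
  have e : ∀ s : ℝ, s ^ ((n : ℝ) + 1 - 1) * Real.exp (-(c * s)) = s ^ n * Real.exp (-(c * s)) := by
    intro s
    rw [add_sub_cancel_right, Real.rpow_natCast]
  simp_rw [e] at h
  have hval : ∫ s in Ioi (0 : ℝ), s ^ n * Real.exp (-(c * s)) = n.factorial / c ^ (n + 1) := by
    rw [h, Real.Gamma_nat_eq_factorial, ← Nat.cast_add_one, Real.rpow_natCast, one_div, inv_pow]
    field_simp
  refine ⟨?_, hval⟩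
  by_contra hcon
  rw [integral_undef hcon] at hval
  have : (0 : ℝ) < n.factorial / c ^ (n + 1) := by positivity
  linarith

/-- The density at `s` of the Gamma distribution of shape `n + 1` and mean `1 / x`. -/
noncomputable def gammaKernel (n : ℕ) (x s : ℝ) : ℝ :=
  ((n + 1) * x) ^ (n + 1) / n.factorial * (s ^ n * Real.exp (-((n + 1) * x * s)))

lemma gammaKernel_nonneg (n : ℕ) {x s : ℝ} (hx : 0 ≤ x) (hs : 0 ≤ s) : 0 ≤ gammaKernel n x s := by
  unfold gammaKernel; positivity

lemma measurable_gammaKernel (n : ℕ) : Measurable fun p : ℝ × ℝ => gammaKernel n p.1 p.2 := by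
  unfold gammaKernel; fun_prop

lemma lintegral_gammaKernel (n : ℕ) {x : ℝ} (hx : 0 < x) :
    ∫⁻ s in Ioi (0 : ℝ), ENNReal.ofReal (gammaKernel n x s) = 1 := by
  obtain ⟨h1, h2⟩ := integral_pow_mul_exp_neg n (c := (n + 1) * x) (by positivity)
  unfold gammaKernel
  rw [← ofReal_integral_eq_lintegral_ofReal (h1.const_mul _), integral_const_mul, h2]
  · rw [← ENNReal.ofReal_one]
    congr 1
    have : (n.factorial : ℝ) ≠ 0 := by positivity
    field_simp
  · filter_upwards [ae_restrict_mem measurableSet_Ioi] with s hs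
    exact gammaKernel_nonneg n hx.le (le_of_lt hs)

/-- A tail bound uniform in `n`. Half of the exponent is spent on `s > A`; the remaining Gamma
integral costs `2^{n+1} ≤ e^{n+1}`, which is absorbed once `A x ≥ 4`. For `A x ≤ 4` the total mass
`1` already suffices. -/
lemma lintegral_gammaKernel_Ioi_le (n : ℕ) {x A : ℝ} (hx : 0 < x) (hA : 0 < A) :
    ∫⁻ s in Ioi A, ENNReal.ofReal (gammaKernel n x s) ≤
      ENNReal.ofReal (Real.exp 1) * ENNReal.ofReal (Real.exp (-(A / 4 * x))) := by
  rw [← ENNReal.ofReal_mul (by positivity), ← Real.exp_add]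
  rcases le_total (A * x) 4 with h | h
  · calc _ ≤ ∫⁻ s in Ioi (0 : ℝ), ENNReal.ofReal (gammaKernel n x s) :=
          lintegral_mono_set (Ioi_subset_Ioi hA.le)
      _ = 1 := lintegral_gammaKernel n hx
      _ ≤ _ := ENNReal.one_le_ofReal.2 (Real.one_le_exp (by linarith))
  · have hc : 0 < ((n : ℝ) + 1) * x / 2 := by positivity
    obtain ⟨h1, h2⟩ := integral_pow_mul_exp_neg n hc
    calc ∫⁻ s in Ioi A, ENNReal.ofReal (gammaKernel n x s)
        ≤ ∫⁻ s in Ioi A, ENNReal.ofReal (Real.exp (-((n + 1) * x / 2 * A)) *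
          (((n + 1) * x) ^ (n + 1) / n.factorial)
            * (s ^ n * Real.exp (-((n + 1) * x / 2 * s)))) := by
          refine setLIntegral_mono (by fun_prop) fun s (hs : A < s) => ?_
          refine ENNReal.ofReal_le_ofReal ?_
          unfold gammaKernel
          have hs0 : 0 < s := hA.trans hs
          have : Real.exp (-((n + 1) * x * s)) ≤ Real.exp (-((n + 1) * x / 2 * A)) *
              Real.exp (-((n + 1) * x / 2 * s)) := by
            rw [← Real.exp_add]
            refine Real.exp_le_exp.2 ?_
            have : (n + 1) * x / 2 * A ≤ (n + 1) * x / 2 * s := by gcongr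
            linarith
          calc _ ≤ ((n + 1) * x) ^ (n + 1) / n.factorial * (s ^ n *
                (Real.exp (-((n + 1) * x / 2 * A)) * Real.exp (-((n + 1) * x / 2 * s)))) := by gcongr
            _ = _ := by ring
      _ ≤ ∫⁻ s in Ioi (0 : ℝ), ENNReal.ofReal (Real.exp (-((n + 1) * x / 2 * A)) *
          (((n + 1) * x) ^ (n + 1) / n.factorial)
            * (s ^ n * Real.exp (-((n + 1) * x / 2 * s)))) := 
          lintegral_mono_set (Ioi_subset_Ioi hA.le)
      _ = ENNReal.ofReal (Real.exp (-((n + 1) * x / 2 * A)) * 2 ^ (n + 1)) := by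
          rw [← ofReal_integral_eq_lintegral_ofReal (h1.const_mul _), integral_const_mul, h2]
          · congr 1
            have : (n.factorial : ℝ) ≠ 0 := by positivity
            rw [div_pow]
            field_simp
          · filter_upwards [ae_restrict_mem measurableSet_Ioi] with s (hs : 0 < s)
            show 0 ≤ _
            positivity
      _ ≤ _ := by
          refine ENNReal.ofReal_le_ofReal ?_
          have h3 : (2 : ℝ) ^ (n + 1) ≤ Real.exp (n + 1) := by
            have := Real.add_one_le_exp (1 : ℝ)
            calc (2 : ℝ) ^ (n + 1) ≤ Real.exp 1 ^ (n + 1) := by gcongr; linarith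
              _ = Real.exp (n + 1) := by rw [← Real.exp_nat_mul]; simp
          calc _ ≤ Real.exp (-((n + 1) * x / 2 * A)) * Real.exp (n + 1) := by gcongr
            _ = Real.exp (-((n + 1) * x / 2 * A) + (n + 1)) := by rw [← Real.exp_add]
            _ ≤ _ := by
              refine Real.exp_le_exp.2 ?_
              have hn : (0 : ℝ) ≤ n := n.cast_nonneg
              nlinarith

/-- Chebyshev's inequality for the Gamma distribution. -/
lemma lintegral_gammaKernel_compl_le (n : ℕ) {x δ : ℝ} (hx : 0 < x) (hδ : 0 < δ) :
    ∫⁻ s in {s | 0 < s ∧ δ ≤ |s - x⁻¹|}, ENNReal.ofReal (gammaKernel n x s) ≤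
      ENNReal.ofReal ((x ^ 2 * δ ^ 2)⁻¹ * (1 / ((n : ℝ) + 1))) := by
  have hc : 0 < ((n : ℝ) + 1) * x := by positivity
  obtain ⟨i0, v0⟩ := integral_pow_mul_exp_neg n hc
  obtain ⟨i1, v1⟩ := integral_pow_mul_exp_neg (n + 1) hc
  obtain ⟨i2, v2⟩ := integral_pow_mul_exp_neg (n + 2) hc
  set K : ℝ := ((n + 1) * x) ^ (n + 1) / n.factorial with hK
  have hK0 : 0 ≤ K := by positivity
  have e : ∀ s : ℝ, (δ ^ 2)⁻¹ * (s - x⁻¹) ^ 2 * gammaKernel n x s =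
      (δ ^ 2)⁻¹ * K * ((s ^ (n + 2) * Real.exp (-((n + 1) * x * s))
        - 2 * x⁻¹ * (s ^ (n + 1) * Real.exp (-((n + 1) * x * s)))) +
        (x⁻¹) ^ 2 * (s ^ n * Real.exp (-((n + 1) * x * s)))) := by
    intro s; unfold gammaKernel; ring
  have hm : MeasurableSet {s : ℝ | 0 < s ∧ δ ≤ |s - x⁻¹|} :=
    measurableSet_Ioi.inter
      (measurableSet_le measurable_const (by fun_prop : Measurable fun s : ℝ => |s - x⁻¹|))
  calc _ ≤ ∫⁻ s in {s | 0 < s ∧ δ ≤ |s - x⁻¹|},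
        ENNReal.ofReal ((δ ^ 2)⁻¹ * (s - x⁻¹) ^ 2 * gammaKernel n x s) := by
        refine setLIntegral_mono' hm fun s hs => ?_
        refine ENNReal.ofReal_le_ofReal (le_mul_of_one_le_left
          (gammaKernel_nonneg n hx.le hs.1.le) ?_)
        rw [inv_mul_eq_div, one_le_div (by positivity), ← sq_abs (s - x⁻¹)]
        exact pow_le_pow_left₀ hδ.le hs.2 2
    _ ≤ ∫⁻ s in Ioi (0 : ℝ), ENNReal.ofReal ((δ ^ 2)⁻¹ * (s - x⁻¹) ^ 2 * gammaKernel n x s) :=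
        lintegral_mono_set fun s hs => hs.1
    _ = _ := by
        have i01 : Integrable (fun s : ℝ => s ^ (n + 2) * Real.exp (-((n + 1) * x * s))
            - 2 * x⁻¹ * (s ^ (n + 1) * Real.exp (-((n + 1) * x * s)))) (volume.restrict (Ioi 0)) :=
          i2.sub (i1.const_mul (2 * x⁻¹))
        rw [← ofReal_integral_eq_lintegral_ofReal]
        · congr 1
          simp_rw [e]
          rw [integral_const_mul, integral_add i01 (i0.const_mul _), integral_sub i2 (i1.const_mul _),
            integral_const_mul, integral_const_mul, v0, v1, v2, hK]
          have : (n.factorial : ℝ) ≠ 0 := by positivity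
          rw [Nat.factorial_succ, Nat.factorial_succ]
          push_cast
          field_simp
          ring
        · refine Integrable.congr ((i01.add (i0.const_mul (x⁻¹ ^ 2))).const_mul ((δ ^ 2)⁻¹ * K)) ?_
          exact Eventually.of_forall fun s => (e s).symm
        · filter_upwards [ae_restrict_mem measurableSet_Ioi] with s (hs : 0 < s)
          have := gammaKernel_nonneg n hx.le hs.le
          show 0 ≤ _
          positivity

/-- The Gamma laws have mean `1/x` and variance `1/((n+1) x²)`, so they concentrate at `x⁻¹`. -/
lemma one_le_liminf_lintegral_gammaKernel {x : ℝ} (hx : 0 < x) {O : Set ℝ} (hO : IsOpen O)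
    (hxO : x⁻¹ ∈ O) :
    1 ≤ liminf (fun n : ℕ => ∫⁻ s in O, ENNReal.ofReal (gammaKernel n x s)) atTop := by
  obtain ⟨δ, hδ, hball⟩ := Metric.isOpen_iff.1 hO _ hxO
  have hb : ∀ n : ℕ, 1 - ENNReal.ofReal ((x ^ 2 * δ ^ 2)⁻¹ * (1 / ((n : ℝ) + 1))) ≤
      ∫⁻ s in O, ENNReal.ofReal (gammaKernel n x s) := by
    intro n
    rw [tsub_le_iff_right, ← lintegral_gammaKernel n hx]
    refine le_trans ?_ (add_le_add_right (lintegral_gammaKernel_compl_le n hx hδ) _)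
    refine le_trans (lintegral_mono_set fun s hs => ?_) (lintegral_union_le _ _ _)
    by_cases h : |s - x⁻¹| < δ
    · exact Or.inl (hball (by rwa [Metric.mem_ball, Real.dist_eq]))
    · exact Or.inr ⟨hs, not_lt.1 h⟩
  have hlim : Tendsto (fun n : ℕ => 1 - ENNReal.ofReal ((x ^ 2 * δ ^ 2)⁻¹ * (1 / ((n : ℝ) + 1))))
      atTop (𝓝 1) := by
    have h1 : Tendsto (fun n : ℕ => (x ^ 2 * δ ^ 2)⁻¹ * (1 / ((n : ℝ) + 1))) atTop (𝓝 0) := by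
      simpa only [mul_zero] using
        (tendsto_one_div_add_atTop_nhds_zero_nat (𝕜 := ℝ)).const_mul (x ^ 2 * δ ^ 2)⁻¹
    have h2 := ENNReal.Tendsto.sub (tendsto_const_nhds (x := (1 : ℝ≥0∞))) (ENNReal.tendsto_ofReal h1)
      (Or.inl (by simp))
    simpa using h2
  rw [← hlim.liminf_eq]
  exact liminf_le_liminf (Eventually.of_forall hb)

/-! ### Absolute continuity through Post-Widder inversion. -/

section

variable {U : Measure ℝ}

/-- The Post-Widder density, in the variable `s = 1 / x`, up to the factor `s⁻²`. -/
noncomputable def postWidder (U : Measure ℝ) (n : ℕ) (s : ℝ) : ℝ :=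
  ((n + 1) * s) ^ (n + 2) * laplaceMoment U (n + 1) ((n + 1) * s) / (n + 1).factorial

lemma laplaceMoment_nonneg (hU : U (Iic 0) = 0) (n : ℕ) (z : ℝ) : 0 ≤ laplaceMoment U n z := by
  have : ∀ᵐ x ∂U, x ∉ Iic (0 : ℝ) := measure_eq_zero_iff_ae_notMem.1 hU
  refine integral_nonneg_of_ae ?_
  filter_upwards [this] with x hx
  have : 0 < x := not_le.1 hx
  show 0 ≤ _
  positivity

/-- The Gamma kernel read as a function of `x` at fixed `s` is a multiple of `x^{n+1} e^{-(n+1) s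
x}`: integrating it against `U` produces a derivative of the Laplace transform. -/
lemma lintegral_gammaKernel_right (hU : U (Iic 0) = 0) (hfin : ∀ z, 0 < z → laplace U z < ∞)
    (n : ℕ) {s : ℝ} (hs : 0 < s) :
    ∫⁻ x, ENNReal.ofReal (gammaKernel n x s) ∂U =
      ENNReal.ofReal ((s ^ 2)⁻¹ * postWidder U n s) := by
  have hc : 0 < ((n : ℝ) + 1) * s := by positivity
  have e : ∀ x, gammaKernel n x s = (n + 1) ^ (n + 1) / n.factorial * s ^ n *
      (x ^ (n + 1) * Real.exp (-((n + 1) * s * x))) := by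
    intro x; unfold gammaKernel; rw [mul_pow]; ring_nf
  have hpos : ∀ᵐ x ∂U, x ∉ Iic (0 : ℝ) := measure_eq_zero_iff_ae_notMem.1 hU
  simp_rw [e]
  rw [← ofReal_integral_eq_lintegral_ofReal
    ((integrable_pow_mul_exp_neg hfin (n + 1) hc).const_mul _), integral_const_mul]
  · congr 1
    unfold postWidder
    change _ * laplaceMoment U (n + 1) ((n + 1) * s) = _
    rw [Nat.factorial_succ]
    have : (n.factorial : ℝ) ≠ 0 := by positivity
    push_cast
    rw [mul_pow]
    field_simp
    ring
  · filter_upwards [hpos] with x hx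
    have : 0 < x := not_le.1 hx
    show 0 ≤ _
    positivity

lemma lintegral_postWidder (hU : U (Iic 0) = 0) (hfin : ∀ z, 0 < z → laplace U z < ∞)
    (n : ℕ) {O : Set ℝ} (hO : MeasurableSet O) (hO0 : O ⊆ Ioi 0) :
    ∫⁻ s in O, ENNReal.ofReal ((s ^ 2)⁻¹ * postWidder U n s) =
      ∫⁻ x, (∫⁻ s in O, ENNReal.ofReal (gammaKernel n x s)) ∂U := by
  have := sigmaFinite_of_laplace (hfin 1 one_pos)
  rw [lintegral_lintegral_swap (measurable_gammaKernel n).ennreal_ofReal.aemeasurable]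
  exact setLIntegral_congr_fun hO fun s hs => (lintegral_gammaKernel_right hU hfin n (hO0 hs)).symm

variable (hU : U (Iic 0) = 0) (hfin : ∀ z, 0 < z → laplace U z < ∞)
    (hder : ∀ n : ℕ, 1 ≤ n → ∀ z : ℝ, 0 < z →
      (-1 : ℝ) ^ n * iteratedDeriv n (fun z => z * (laplace U z).toReal) z ≤ 0)

include hfin hder in
lemma monotoneOn_postWidder (n : ℕ) : MonotoneOn (postWidder U n) (Ioi 0) := by
  intro s hs t ht hst
  have hs : 0 < s := hs
  have ht : 0 < t := ht
  unfold postWidder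
  have := monotoneOn_pow_mul_laplaceMoment hfin hder (n + 1)
    (a := (n + 1) * s) (b := (n + 1) * t) (mem_Ioi.2 (by positivity)) (mem_Ioi.2 (by positivity))
    (by gcongr)
  simp only at this
  gcongr ?_ / _

include hU hfin hder in
-- By monotonicity the value at `A` is controlled by the integral over `(A, 2A)`, which the Gamma
-- tail bound estimates independently of `n`. The factor `4 A²` bounds `s²` there.
lemma postWidder_le {A : ℝ} (hA : 0 < A) (n : ℕ) :
    ENNReal.ofReal (postWidder U n A) ≤
      ENNReal.ofReal (4 * A) * (ENNReal.ofReal (Real.exp 1) * laplace U (A / 4)) := by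
  have hpos : ∀ᵐ x ∂U, x ∉ Iic (0 : ℝ) := measure_eq_zero_iff_ae_notMem.1 hU
  have h1 : ∫⁻ s in Ioo A (2 * A), ENNReal.ofReal ((s ^ 2)⁻¹ * postWidder U n s) ≤
      ENNReal.ofReal (Real.exp 1) * laplace U (A / 4) := by
    rw [lintegral_postWidder hU hfin n measurableSet_Ioo fun s hs => hA.trans hs.1]
    unfold laplace
    rw [← lintegral_const_mul _ (by fun_prop)]
    refine lintegral_mono_ae ?_
    filter_upwards [hpos] with x hx
    exact (lintegral_mono_set fun s hs => hs.1).trans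
      (lintegral_gammaKernel_Ioi_le n (not_le.1 hx) hA)
  have h2 : ENNReal.ofReal ((4 * A ^ 2)⁻¹ * postWidder U n A) * ENNReal.ofReal A ≤
      ∫⁻ s in Ioo A (2 * A), ENNReal.ofReal ((s ^ 2)⁻¹ * postWidder U n s) := by
    have : ENNReal.ofReal A = volume (Ioo A (2 * A)) := by rw [Real.volume_Ioo]; ring_nf
    rw [this, ← setLIntegral_const]
    refine setLIntegral_mono' measurableSet_Ioo fun s hs => ENNReal.ofReal_le_ofReal ?_
    have hs0 : 0 < s := hA.trans hs.1
    have h3 := monotoneOn_postWidder hfin hder n (mem_Ioi.2 hA) (mem_Ioi.2 hs0) hs.1.le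
    have h4 : 0 ≤ postWidder U n A := by
      have := laplaceMoment_nonneg hU (n + 1) ((n + 1) * A)
      unfold postWidder; positivity
    have h5 : s ^ 2 ≤ 4 * A ^ 2 := by nlinarith [hs.2]
    gcongr
  have h3 : ENNReal.ofReal (postWidder U n A) = ENNReal.ofReal (4 * A) *
      (ENNReal.ofReal ((4 * A ^ 2)⁻¹ * postWidder U n A) * ENNReal.ofReal A) := by
    rw [← ENNReal.ofReal_mul' hA.le, ← ENNReal.ofReal_mul (by positivity)]
    congr 1
    field_simp
  rw [h3]
  exact mul_le_mul_right (h2.trans h1) _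

include hU hfin hder in
-- Concentration bounds the indicator of `x⁻¹ ∈ O` by the liminf of the kernel masses of `O`. Fatou
-- and Tonelli then reduce the claim to the bound on the Post-Widder densities over `(ε, A)`,
-- uniform in `n`.
lemma measure_preimage_inv_le {ε A : ℝ} (hε : 0 < ε) (hA : 0 < A) {O : Set ℝ} (hO : IsOpen O)
    (hOs : O ⊆ Ioo ε A) :
    U ((fun x => x⁻¹) ⁻¹' O) ≤ (ENNReal.ofReal ((ε ^ 2)⁻¹) *
      (ENNReal.ofReal (4 * A) * (ENNReal.ofReal (Real.exp 1) * laplace U (A / 4)))) * volume O := by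
  have hO0 : O ⊆ Ioi 0 := fun s hs => hε.trans (hOs hs).1
  have hpos : ∀ᵐ x ∂U, x ∉ Iic (0 : ℝ) := measure_eq_zero_iff_ae_notMem.1 hU
  have hm : ∀ n, Measurable fun x => ∫⁻ s in O, ENNReal.ofReal (gammaKernel n x s) := fun n =>
    (measurable_gammaKernel n).ennreal_ofReal.lintegral_prod_right'
  calc U ((fun x => x⁻¹) ⁻¹' O)
      ≤ ∫⁻ x, liminf (fun n : ℕ => ∫⁻ s in O, ENNReal.ofReal (gammaKernel n x s)) atTop ∂U := by
        rw [← lintegral_indicator_one (measurable_inv hO.measurableSet)]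
        refine lintegral_mono_ae ?_
        filter_upwards [hpos] with x hx
        by_cases hxO : x ∈ (fun x : ℝ => x⁻¹) ⁻¹' O
        · rw [indicator_of_mem hxO]
          exact one_le_liminf_lintegral_gammaKernel (not_le.1 hx) hO hxO
        · rw [indicator_of_notMem hxO]
          exact zero_le
    _ ≤ liminf (fun n : ℕ => ∫⁻ x, (∫⁻ s in O, ENNReal.ofReal (gammaKernel n x s)) ∂U) atTop :=
        lintegral_liminf_le hm
    _ ≤ _ := by
        refine (liminf_le_liminf (Eventually.of_forall fun n => ?_)).trans
          (le_of_eq (liminf_const _))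
        rw [← lintegral_postWidder hU hfin n hO.measurableSet hO0, ← setLIntegral_const]
        refine setLIntegral_mono' hO.measurableSet fun s hs => ?_
        have hs0 : 0 < s := hO0 hs
        rw [ENNReal.ofReal_mul (by positivity)]
        gcongr
        · exact (hOs hs).1.le
        · exact (ENNReal.ofReal_le_ofReal (monotoneOn_postWidder hfin hder n (mem_Ioi.2 hs0)
            (mem_Ioi.2 hA) (hOs hs).2.le)).trans (postWidder_le hU hfin hder hA n)

include hU hfin hder in
/-- A measure on `(0, ∞)` with Laplace transform `L` such that `z L(z)` is a Bernstein function
is absolutely continuous. -/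
theorem absolutelyContinuous_of_laplace : U ≪ volume := by
  have key : ∀ k : ℕ, ∀ S ⊆ Ioo (((k : ℝ) + 1)⁻¹) (k + 1), volume S = 0 → U S = 0 := by
    intro k S hS hS0
    have hk : (0 : ℝ) < (k : ℝ) + 1 := by positivity
    set S' : Set ℝ := (fun x => x⁻¹) '' S with hS'
    -- Inversion is differentiable away from `0` and so preserves null sets; the image can then be
    -- covered by open sets of arbitrarily small measure.
    have h0 : volume S' = 0 := by
      refine addHaar_image_eq_zero_of_differentiableOn_of_addHaar_eq_zero volume ?_ hS0
      intro x hx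
      exact (differentiableAt_inv ((inv_pos.2 hk).trans (hS hx).1).ne').differentiableWithinAt
    have hsub : S' ⊆ Ioo (((k : ℝ) + 1)⁻¹) (k + 1) := by
      rintro _ ⟨x, hx, rfl⟩
      have hx0 : 0 < x := (inv_pos.2 hk).trans (hS hx).1
      exact ⟨(inv_lt_inv₀ hk hx0).2 (hS hx).2, (inv_lt_comm₀ hk hx0).1 (hS hx).1⟩
    set K : ℝ≥0∞ := ENNReal.ofReal (((((k : ℝ) + 1)⁻¹) ^ 2)⁻¹) * (ENNReal.ofReal (4 * (k + 1)) *
      (ENNReal.ofReal (Real.exp 1) * laplace U (((k : ℝ) + 1) / 4))) with hK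
    have hKtop : K ≠ ∞ := by
      have := (hfin (((k : ℝ) + 1) / 4) (by positivity)).ne
      exact ENNReal.mul_ne_top ENNReal.ofReal_ne_top (ENNReal.mul_ne_top ENNReal.ofReal_ne_top
        (ENNReal.mul_ne_top ENNReal.ofReal_ne_top this))
    have hle : ∀ δ : ℝ≥0, 0 < δ → U S ≤ K * δ := by
      intro δ hδ
      obtain ⟨O, hSO, hO, hOδ⟩ := S'.exists_isOpen_lt_of_lt (μ := volume) δ (by rw [h0]; exact_mod_cast hδ)
      have h1 := measure_preimage_inv_le hU hfin hder (inv_pos.2 hk) hk (hO.inter isOpen_Ioo)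
        (inter_subset_right : O ∩ Ioo (((k : ℝ) + 1)⁻¹) (k + 1) ⊆ _)
      refine (measure_mono ?_).trans (h1.trans ?_)
      · intro x hx
        have hx' : x⁻¹ ∈ S' := mem_image_of_mem _ hx
        exact ⟨hSO hx', hsub hx'⟩
      · gcongr
        exact (measure_mono inter_subset_left).trans hOδ.le
    have hlim : Tendsto (fun n : ℕ => K * ((1 / ((n : ℝ≥0) + 1) : ℝ≥0) : ℝ≥0∞)) atTop (𝓝 0) := by
      have h2 : Tendsto (fun n : ℕ => 1 / ((n : ℝ≥0) + 1)) atTop (𝓝 0) :=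
        NNReal.tendsto_coe.1 (by simpa using tendsto_one_div_add_atTop_nhds_zero_nat (𝕜 := ℝ))
      simpa using ENNReal.Tendsto.const_mul (ENNReal.tendsto_coe.2 h2) (Or.inr hKtop)
    exact le_antisymm (ge_of_tendsto' hlim fun n => hle _ (by positivity)) zero_le
  intro S hS
  have hcov : S ⊆ Iic 0 ∪ ⋃ k : ℕ, S ∩ Ioo (((k : ℝ) + 1)⁻¹) (k + 1) := by
    intro x hx
    rcases le_or_gt x 0 with h | h
    · exact Or.inl h
    · right
      obtain ⟨k, hk⟩ := exists_nat_gt (max x x⁻¹)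
      refine mem_iUnion.2 ⟨k, hx, ?_, ?_⟩
      · rw [inv_lt_comm₀ (by positivity) h]
        linarith [le_max_right x x⁻¹]
      · linarith [le_max_left x x⁻¹]
  refine measure_mono_null hcov (measure_union_null hU (measure_iUnion_null fun k => ?_))
  exact key k _ inter_subset_right (measure_mono_null inter_subset_left hS)

end

/-! ### The Sonine pair, the renewal equation and Grönwall's inequality. -/

lemma conv_Iio_zero {μ ρ : Measure ℝ} [SFinite ρ] (hμ : μ (Iio 0) = 0) (hρ : ρ (Iio 0) = 0) :
    (μ ∗ ρ) (Iio 0) = 0 := by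
  have h1 : ∀ᵐ x ∂μ, x ∉ Iio (0 : ℝ) := measure_eq_zero_iff_ae_notMem.1 hμ
  have h2 : ∀ᵐ x ∂ρ, x ∉ Iio (0 : ℝ) := measure_eq_zero_iff_ae_notMem.1 hρ
  rw [← lintegral_indicator_one measurableSet_Iio,
    Measure.lintegral_conv (measurable_one.indicator measurableSet_Iio)]
  refine lintegral_eq_zero_of_ae_eq_zero ?_
  filter_upwards [h1] with x hx
  refine lintegral_eq_zero_of_ae_eq_zero ?_
  filter_upwards [h2] with y hy
  have : ¬ x + y < 0 := by
    simp only [mem_Iio, not_lt] at hx hy ⊢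
    linarith
  simp [this]

lemma conv_Iic (μ ρ : Measure ℝ) [SFinite ρ] (t : ℝ) :
    (μ ∗ ρ) (Iic t) = ∫⁻ s, ρ (Iic (t - s)) ∂μ := by
  rw [← lintegral_indicator_one measurableSet_Iic,
    Measure.lintegral_conv (measurable_one.indicator measurableSet_Iic)]
  refine lintegral_congr fun s => ?_
  rw [← lintegral_indicator_one measurableSet_Iic]
  refine lintegral_congr fun y => ?_
  simp only [indicator, mem_Iic, le_sub_iff_add_le, add_comm, Pi.one_apply]

lemma tailMeasure_Iio (ν : Measure ℝ) : tailMeasure ν (Iio 0) = 0 := by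
  refine withDensity_absolutelyContinuous _ _ ?_
  rw [Measure.restrict_apply measurableSet_Iio]
  have : Iio (0 : ℝ) ∩ Ioi 0 = ∅ := by ext x; simpa using le_of_lt
  simp [this]

section

variable {Ω : Type*} [MeasurableSpace Ω] {P : Measure Ω} [IsProbabilityMeasure P]
  {σ : ℝ≥0 → Ω → ℝ} {Φ : ℝ → ℝ} {ν : Measure ℝ}

lemma laplace_potentialMeasure (hσ : IsSubordinator P σ) (hσΦ : HasLaplaceExponent P σ Φ)
    (hΦ : IsSpecialBernstein Φ) {z : ℝ} (hz : 0 < z) :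
    laplace (potentialMeasure P σ) z = ENNReal.ofReal (Φ z)⁻¹ := by
  rw [← expPotential_zero, hσ.laplace_expPotential hσΦ hz (hΦ.pos hz), sub_zero]

lemma potentialMeasure_Iio (hσ : IsSubordinator P σ) : potentialMeasure P σ (Iio 0) = 0 := by
  rw [← expPotential_zero, hσ.expPotential_Iio]

/-- Chernoff at `t = 0` gives `U{0} ≤ 1/Φ(z)`, and `z → ∞`. -/
lemma potentialMeasure_Iic (hσ : IsSubordinator P σ) (hσΦ : HasLaplaceExponent P σ Φ)
    (hΦ : IsSpecialBernstein Φ) (htop : Tendsto Φ atTop atTop) :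
    potentialMeasure P σ (Iic 0) = 0 := by
  have h1 : Tendsto (fun z => ENNReal.ofReal (Φ z)⁻¹) atTop (𝓝 0) := by
    simpa using ENNReal.tendsto_ofReal (tendsto_inv_atTop_zero.comp htop)
  refine le_antisymm (ge_of_tendsto h1 ?_) zero_le
  filter_upwards [eventually_gt_atTop 0] with z hz
  simpa [laplace_potentialMeasure hσ hσΦ hΦ hz] using
    measure_Iic_le_laplace (potentialMeasure P σ) hz.le 0

/-- This is where speciality enters: `z` times the transform of `U` is the conjugate `z/Φ(z)`. -/
lemma potentialMeasure_absolutelyContinuous (hσ : IsSubordinator P σ)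
    (hσΦ : HasLaplaceExponent P σ Φ) (hΦ : IsSpecialBernstein Φ)
    (htop : Tendsto Φ atTop atTop) : potentialMeasure P σ ≪ volume := by
  refine absolutelyContinuous_of_laplace (potentialMeasure_Iic hσ hσΦ hΦ htop)
    (fun z hz => by rw [laplace_potentialMeasure hσ hσΦ hΦ hz]; exact ENNReal.ofReal_lt_top)
    fun n hn z hz => ?_
  have hev : (fun z => z * (laplace (potentialMeasure P σ) z).toReal) =ᶠ[𝓝 z] fun z => z / Φ z := by
    filter_upwards [Ioi_mem_nhds hz] with w hw
    rw [laplace_potentialMeasure hσ hσΦ hΦ hw,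
      ENNReal.toReal_ofReal (inv_nonneg.2 (hΦ.pos hw).le), div_eq_mul_inv]
  rw [hev.iteratedDeriv_eq]
  exact hΦ.conjugate.iteratedDeriv_nonpos n hn z hz

lemma sigmaFinite_tailMeasure (hν : IsLevyTriple Φ 0 0 ν) : SigmaFinite (tailMeasure ν) :=
  sigmaFinite_of_laplace (z := 1) (by
    rw [hν.laplace_tailMeasure one_pos]; exact ENNReal.ofReal_lt_top)

/-- The potential measure and the tail of the Lévy measure form a Sonine pair. -/
theorem potentialMeasure_conv_tailMeasure (hσ : IsSubordinator P σ)
    (hσΦ : HasLaplaceExponent P σ Φ) (hΦ : IsSpecialBernstein Φ) (hν : IsLevyTriple Φ 0 0 ν) :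
    potentialMeasure P σ ∗ tailMeasure ν = volume.restrict (Ici (0 : ℝ)) := by
  have := sigmaFinite_tailMeasure hν
  have hL : ∀ z : ℝ, 1 ≤ z → laplace (potentialMeasure P σ ∗ tailMeasure ν) z =
      laplace (volume.restrict (Ici (0 : ℝ))) z := by
    intro z hz
    have hz : 0 < z := by linarith
    rw [laplace_conv, laplace_potentialMeasure hσ hσΦ hΦ hz, hν.laplace_tailMeasure hz,
      laplace_volume hz, ← ENNReal.ofReal_mul (inv_nonneg.2 (hΦ.pos hz).le)]
    congr 1
    have := hΦ.ne_zero z hz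
    field_simp
  refine Measure.ext_of_laplace (conv_Iio_zero (potentialMeasure_Iio hσ) (tailMeasure_Iio ν))
    ?_ 1 ?_ hL
  · rw [Measure.restrict_apply measurableSet_Iio]
    have : Iio (0 : ℝ) ∩ Ici 0 = ∅ := by ext; simp
    simp [this]
  · rw [hL 1 le_rfl, laplace_volume one_pos]
    exact ENNReal.ofReal_lt_top

lemma exists_lt_forall_of_tendsto (htop : Tendsto Φ atTop atTop) (l : ℝ) :
    ∃ z₀ : ℝ, 0 < z₀ ∧ ∀ z, z₀ ≤ z → l < Φ z := by
  obtain ⟨z₀, h⟩ := eventually_atTop.1 (htop.eventually_gt_atTop l)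
  exact ⟨max z₀ 1, by positivity, fun z hz => h z ((le_max_left _ _).trans hz)⟩

/-- The resolvent equation for the weighted potential measures. -/
theorem expPotential_eq (hσ : IsSubordinator P σ) (hσΦ : HasLaplaceExponent P σ Φ)
    (hΦ : IsSpecialBernstein Φ) (htop : Tendsto Φ atTop atTop) {l : ℝ} (hl : 0 < l) :
    expPotential P σ l = potentialMeasure P σ +
      ENNReal.ofReal l • (potentialMeasure P σ ∗ expPotential P σ l) := by
  obtain ⟨z₀, hz₀, hz₀'⟩ := exists_lt_forall_of_tendsto htop l
  have hfin : laplace (expPotential P σ l) z₀ < ∞ := by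
    rw [hσ.laplace_expPotential hσΦ hz₀ (hz₀' z₀ le_rfl)]; exact ENNReal.ofReal_lt_top
  have := sigmaFinite_of_laplace hfin
  -- In transforms, for `z` so large that `Φ(z) > l`, the identity is `1/(Φ - l) = 1/Φ + l/(Φ (Φ -
  -- l))`.
  refine Measure.ext_of_laplace (hσ.expPotential_Iio l) ?_ z₀ hfin fun z hz => ?_
  · simp [potentialMeasure_Iio hσ,
      conv_Iio_zero (potentialMeasure_Iio hσ) (hσ.expPotential_Iio l)]
  · have hz0 : 0 < z := hz₀.trans_le hz
    have h1 : laplace (potentialMeasure P σ +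
        ENNReal.ofReal l • (potentialMeasure P σ ∗ expPotential P σ l)) z =
        laplace (potentialMeasure P σ) z +
          ENNReal.ofReal l * laplace (potentialMeasure P σ ∗ expPotential P σ l) z := by
      unfold laplace
      rw [lintegral_add_measure, lintegral_smul_measure, smul_eq_mul]
    have h2 := hΦ.pos hz0
    have h3 : 0 < Φ z - l := sub_pos.2 (hz₀' z hz)
    rw [h1, laplace_conv, laplace_potentialMeasure hσ hσΦ hΦ hz0,
      hσ.laplace_expPotential hσΦ hz0 (hz₀' z hz), ← ENNReal.ofReal_mul (by positivity),
      ← ENNReal.ofReal_mul hl.le, ← ENNReal.ofReal_add (by positivity) (by positivity)]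
    congr 1
    field_simp
    ring

lemma expPotential_Iic_lt_top (hσ : IsSubordinator P σ) (hσΦ : HasLaplaceExponent P σ Φ)
    (htop : Tendsto Φ atTop atTop) (l t : ℝ) : expPotential P σ l (Iic t) < ∞ := by
  obtain ⟨z₀, hz₀, hz₀'⟩ := exists_lt_forall_of_tendsto htop l
  refine (measure_Iic_le_laplace _ hz₀.le t).trans_lt ?_
  rw [hσ.laplace_expPotential hσΦ hz₀ (hz₀' z₀ le_rfl)]
  exact ENNReal.mul_lt_top ENNReal.ofReal_lt_top ENNReal.ofReal_lt_top

/-- The renewal equation `𝔢(t) = 1 + l ∫_{[0, t]} 𝔢(t - s) U(ds)` for `𝔢(t) = 1 + l V[0, t]`. -/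
lemma expPotential_Iic_eq (hσ : IsSubordinator P σ) (hσΦ : HasLaplaceExponent P σ Φ)
    (hΦ : IsSpecialBernstein Φ) (htop : Tendsto Φ atTop atTop) {l : ℝ} (hl : 0 < l) (t : ℝ) :
    expPotential P σ l (Iic t) = ∫⁻ s in Icc 0 t,
      (1 + ENNReal.ofReal l * expPotential P σ l (Iic (t - s))) ∂(potentialMeasure P σ) := by
  obtain ⟨z₀, hz₀, hz₀'⟩ := exists_lt_forall_of_tendsto htop l
  have := sigmaFinite_of_laplace (μ := expPotential P σ l) (z := z₀) (by
    rw [hσ.laplace_expPotential hσΦ hz₀ (hz₀' z₀ le_rfl)]; exact ENNReal.ofReal_lt_top)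
  have hU : ∀ᵐ x ∂(potentialMeasure P σ), x ∉ Iio (0 : ℝ) :=
    measure_eq_zero_iff_ae_notMem.1 (potentialMeasure_Iio hσ)
  have h1 : Iic t =ᵐ[potentialMeasure P σ] Icc 0 t := by
    filter_upwards [hU] with s hs
    simp only [mem_Iio, not_lt] at hs
    exact propext ⟨fun h => ⟨hs, h⟩, fun h => h.2⟩
  conv_lhs => rw [expPotential_eq hσ hσΦ hΦ htop hl]
  rw [Measure.add_apply, Measure.smul_apply, conv_Iic, smul_eq_mul,
    lintegral_add_left measurable_const, lintegral_const_mul' _ _ ENNReal.ofReal_ne_top,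
    setLIntegral_const, one_mul, measure_congr h1]
  congr 2
  rw [← setLIntegral_congr h1]
  refine (setLIntegral_eq_of_support_subset ?_).symm
  intro s hs
  by_contra hst
  refine hs (measure_mono_null (fun x (hx : x ≤ t - s) => ?_) (hσ.expPotential_Iio l))
  simp only [mem_Iic, not_le, mem_Iio] at hst ⊢
  linarith

/-- Grönwall's inequality for the potential measure. -/
theorem gronwall_potentialMeasure (hσ : IsSubordinator P σ) (hσΦ : HasLaplaceExponent P σ Φ)
    (hΦ : IsSpecialBernstein Φ) (htop : Tendsto Φ atTop atTop) {l : ℝ} (hl : 0 < l) {T : ℝ}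
    {m : ℝ → ℝ≥0∞} {a B : ℝ≥0∞} (hB : B ≠ ∞) (hmB : ∀ t ∈ Icc 0 T, m t ≤ B)
    (hm : ∀ t ∈ Icc 0 T, m t ≤ a +
      ENNReal.ofReal l * ∫⁻ s in Icc 0 t, m (t - s) ∂(potentialMeasure P σ)) :
    ∀ t ∈ Icc 0 T, m t ≤ a * (1 + ENNReal.ofReal l * expPotential P σ l (Iic t)) := by
  obtain ⟨z, hz, hz'⟩ := exists_lt_forall_of_tendsto htop l
  have hlz : l < Φ z := hz' z le_rfl
  -- In the weight `e^{z t}`, convolution with `l U` has norm at most `l/Φ(z) < 1`. The error of the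
  -- `k`-th iterate is therefore `B θ^k e^{z t}`.
  set θ : ℝ≥0∞ := ENNReal.ofReal (l / Φ z) with hθ
  set U := potentialMeasure P σ with hU
  have hmV : Measurable fun s : ℝ => expPotential P σ l (Iic s) :=
    Monotone.measurable fun _ _ h => measure_mono (Iic_subset_Iic.2 h)
  have hmV' : ∀ t : ℝ, Measurable fun s : ℝ =>
      1 + ENNReal.ofReal l * expPotential P σ l (Iic (t - s)) := fun t =>
    ((hmV.comp (measurable_const.sub measurable_id)).const_mul _).const_add _
  have key : ∀ k : ℕ, ∀ t ∈ Icc 0 T, m t ≤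
      a * (1 + ENNReal.ofReal l * expPotential P σ l (Iic t)) +
        B * θ ^ k * ENNReal.ofReal (Real.exp (z * t)) := by
    intro k
    induction k with
    | zero =>
      intro t ht
      refine (hmB t ht).trans (le_add_left ?_)
      rw [pow_zero, mul_one]
      refine le_mul_of_one_le_right zero_le (ENNReal.one_le_ofReal.2 (Real.one_le_exp ?_))
      exact mul_nonneg hz.le ht.1
    | succ k ih =>
      intro t ht
      have h1 : ∫⁻ s in Icc 0 t, m (t - s) ∂U ≤ ∫⁻ s in Icc 0 t,
          (a * (1 + ENNReal.ofReal l * expPotential P σ l (Iic (t - s))) +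
            B * θ ^ k * ENNReal.ofReal (Real.exp (z * (t - s)))) ∂U :=
        setLIntegral_mono' measurableSet_Icc fun s hs => ih (t - s)
          ⟨sub_nonneg.2 hs.2, (sub_le_self t hs.1).trans ht.2⟩
      have h2 : ∫⁻ s in Icc 0 t, ENNReal.ofReal (Real.exp (z * (t - s))) ∂U ≤
          ENNReal.ofReal (Real.exp (z * t)) * ENNReal.ofReal (Φ z)⁻¹ := by
        rw [← laplace_potentialMeasure hσ hσΦ hΦ hz, laplace,
          ← lintegral_const_mul _ (by fun_prop)]
        refine (setLIntegral_le_lintegral _ _).trans (le_of_eq (lintegral_congr fun s => ?_))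
        rw [← ENNReal.ofReal_mul (by positivity), ← Real.exp_add]
        ring_nf
      have h3 : ENNReal.ofReal l * ENNReal.ofReal (Φ z)⁻¹ = θ := by
        rw [← ENNReal.ofReal_mul hl.le, hθ, div_eq_mul_inv]
      refine (hm t ht).trans ?_
      -- The main term reproduces itself by the renewal equation, so only the error term changes.
      rw [lintegral_add_right _ (by fun_prop), lintegral_const_mul _ (hmV' t),
        lintegral_const_mul _ (by fun_prop), ← expPotential_Iic_eq hσ hσΦ hΦ htop hl t] at h1
      calc a + ENNReal.ofReal l * ∫⁻ s in Icc 0 t, m (t - s) ∂U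
          ≤ a + ENNReal.ofReal l * (a * expPotential P σ l (Iic t) + B * θ ^ k *
            (ENNReal.ofReal (Real.exp (z * t)) * ENNReal.ofReal (Φ z)⁻¹)) := by
            gcongr
            exact h1.trans (by gcongr)
        _ = a * (1 + ENNReal.ofReal l * expPotential P σ l (Iic t)) + B * θ ^ k *
            (ENNReal.ofReal l * ENNReal.ofReal (Φ z)⁻¹) * ENNReal.ofReal (Real.exp (z * t)) := by
            ring
        _ = _ := by rw [h3, pow_succ]; ring
  intro t ht
  have hθ1 : θ < 1 := by
    rw [hθ, ← ENNReal.ofReal_one]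
    exact (ENNReal.ofReal_lt_ofReal_iff one_pos).2 ((div_lt_one (hΦ.pos hz)).2 hlz)
  have hlim : Tendsto (fun k : ℕ => a * (1 + ENNReal.ofReal l * expPotential P σ l (Iic t)) +
        B * θ ^ k * ENNReal.ofReal (Real.exp (z * t))) atTop
      (𝓝 (a * (1 + ENNReal.ofReal l * expPotential P σ l (Iic t)) + 0)) := by
    refine Tendsto.const_add _ ?_
    have h1 := ENNReal.Tendsto.const_mul (ENNReal.tendsto_pow_atTop_nhds_zero_of_lt_one hθ1)
      (Or.inr hB)
    have h2 := ENNReal.Tendsto.mul_const (b := ENNReal.ofReal (Real.exp (z * t))) h1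
      (Or.inr ENNReal.ofReal_ne_top)
    simpa using h2
  rw [add_zero] at hlim
  exact ge_of_tendsto' hlim fun k => key k t ht

end

/-! ### Convolution of causal functions with causal measures. -/

section

variable {X : Type*} [NormedAddCommGroup X] [NormedSpace ℝ X]

/-- Convolution of a measure with a function. -/
noncomputable def mconvolution (μ : Measure ℝ) (h : ℝ → X) (t : ℝ) : X :=
  ∫ x, h (t - x) ∂μ

/-- Strongly measurable, locally bounded functions vanishing on the negative half-line. -/
structure IsCausal (h : ℝ → X) : Prop where
  stronglyMeasurable : StronglyMeasurable h
  eq_zero : ∀ s < 0, h s = 0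
  bounded : ∀ t, ∃ C, ∀ s ≤ t, ‖h s‖ ≤ C

/-- Measures on `[0, ∞)` that are finite on bounded sets. -/
structure IsCausalMeasure (μ : Measure ℝ) : Prop where
  carried : μ (Iio 0) = 0
  finite : ∀ t, μ (Iic t) < ∞

lemma IsCausalMeasure.ae_nonneg {μ : Measure ℝ} (hμ : IsCausalMeasure μ) : ∀ᵐ x ∂μ, 0 ≤ x := by
  have : ∀ᵐ x ∂μ, x ∉ Iio (0 : ℝ) := measure_eq_zero_iff_ae_notMem.1 hμ.carried
  filter_upwards [this] with x hx using not_lt.1 hx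

lemma IsCausalMeasure.sigmaFinite {μ : Measure ℝ} (hμ : IsCausalMeasure μ) : SigmaFinite μ := by
  refine ⟨⟨⟨fun n : ℕ => Iic (n : ℝ), fun _ => trivial, fun n => hμ.finite n, ?_⟩⟩⟩
  ext x
  simpa using exists_nat_ge x

lemma IsCausalMeasure.conv {μ ρ : Measure ℝ} (hμ : IsCausalMeasure μ) (hρ : IsCausalMeasure ρ) :
    IsCausalMeasure (μ ∗ ρ) := by
  have := hρ.sigmaFinite
  refine ⟨conv_Iio_zero hμ.carried hρ.carried, fun t => ?_⟩
  rw [conv_Iic]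
  calc ∫⁻ s, ρ (Iic (t - s)) ∂μ ≤ ∫⁻ s, (Iic t).indicator (fun _ => ρ (Iic t)) s ∂μ := by
        refine lintegral_mono_ae ?_
        filter_upwards [hμ.ae_nonneg] with s hs
        by_cases hst : s ∈ Iic t
        · rw [indicator_of_mem hst]
          exact measure_mono (Iic_subset_Iic.2 (by linarith))
        · rw [indicator_of_notMem hst]
          refine (measure_mono_null (fun x (hx : x ≤ t - s) => ?_) hρ.carried).le
          simp only [mem_Iic, not_le, mem_Iio] at hst ⊢
          linarith
    _ < ∞ := by
        rw [lintegral_indicator measurableSet_Iic, setLIntegral_const]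
        exact ENNReal.mul_lt_top (hρ.finite t) (hμ.finite t)

lemma isCausalMeasure_of_laplace {μ : Measure ℝ} (h0 : μ (Iio 0) = 0) {z : ℝ} (hz : 0 ≤ z)
    (h : laplace μ z < ∞) : IsCausalMeasure μ :=
  ⟨h0, fun t => (measure_Iic_le_laplace μ hz t).trans_lt
    (ENNReal.mul_lt_top ENNReal.ofReal_lt_top h)⟩

omit [NormedSpace ℝ X] in
lemma IsCausal.integrable {h : ℝ → X} (hh : IsCausal h) {μ : Measure ℝ} (hμ : IsCausalMeasure μ)
    (t : ℝ) : Integrable (fun x => h (t - x)) μ := by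
  obtain ⟨C, hC⟩ := hh.bounded t
  have hi : Integrable ((Iic t).indicator fun _ => C) μ :=
    (integrable_indicator_iff measurableSet_Iic).2 (integrableOn_const (hμ.finite t).ne)
  refine hi.mono' (hh.stronglyMeasurable.comp_measurable
    (measurable_const.sub measurable_id)).aestronglyMeasurable ?_
  filter_upwards [hμ.ae_nonneg] with x hx
  by_cases hxt : x ∈ Iic t
  · rw [indicator_of_mem hxt]
    exact hC _ (by linarith)
  · rw [indicator_of_notMem hxt, hh.eq_zero _ (by simp at hxt; linarith), norm_zero]

lemma mconvolution_mconvolution {h : ℝ → X} (hh : IsCausal h) {μ ρ : Measure ℝ}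
    (hμ : IsCausalMeasure μ) (hρ : IsCausalMeasure ρ) (t : ℝ) :
    mconvolution μ (mconvolution ρ h) t = mconvolution (μ ∗ ρ) h t := by
  have := hμ.sigmaFinite
  have := hρ.sigmaFinite
  unfold mconvolution
  rw [integral_conv (hh.integrable (hμ.conv hρ) t)]
  simp_rw [sub_sub]

lemma mconvolution_congr {μ : Measure ℝ} (hμ : IsCausalMeasure μ) {h k : ℝ → X} {t : ℝ}
    (hhk : ∀ s ≤ t, h s = k s) : mconvolution μ h t = mconvolution μ k t := by
  refine integral_congr_ae ?_
  filter_upwards [hμ.ae_nonneg] with x hx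
  exact hhk _ (by linarith)

lemma mconvolution_of_neg {μ : Measure ℝ} (hμ : IsCausalMeasure μ) {h : ℝ → X} (hh : IsCausal h)
    {t : ℝ} (ht : t < 0) : mconvolution μ h t = 0 := by
  rw [mconvolution_congr hμ (k := 0) fun s hs => hh.eq_zero s (by linarith)]
  simp [mconvolution]

lemma isCausalMeasure_volume : IsCausalMeasure (volume.restrict (Ici (0 : ℝ))) := by
  refine isCausalMeasure_of_laplace ?_ zero_le_one (z := 1) ?_
  · rw [Measure.restrict_apply measurableSet_Iio]
    have : Iio (0 : ℝ) ∩ Ici 0 = ∅ := by ext; simp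
    simp [this]
  · rw [laplace_volume one_pos]; exact ENNReal.ofReal_lt_top

lemma mconvolution_eq_setIntegral {μ : Measure ℝ} (hμ : IsCausalMeasure μ) {h : ℝ → X}
    (hh : IsCausal h) (t : ℝ) : mconvolution μ h t = ∫ x in Icc 0 t, h (t - x) ∂μ := by
  rw [← integral_indicator measurableSet_Icc]
  refine integral_congr_ae ?_
  filter_upwards [hμ.ae_nonneg] with x hx
  by_cases hxt : x ≤ t
  · rw [indicator_of_mem (mem_Icc.2 ⟨hx, hxt⟩)]
  · rw [indicator_of_notMem (fun h => hxt h.2), hh.eq_zero _ (by linarith)]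

lemma mconvolution_volume {h : ℝ → X} (hh : IsCausal h) {t : ℝ} (ht : 0 ≤ t) :
    mconvolution (volume.restrict (Ici (0 : ℝ))) h t = ∫ s in (0 : ℝ)..t, h s := by
  rw [mconvolution_eq_setIntegral isCausalMeasure_volume hh, Measure.restrict_restrict measurableSet_Icc,
    inter_eq_left.2 (fun x hx => hx.1), integral_Icc_eq_integral_Ioc,
    ← intervalIntegral.integral_of_le ht, intervalIntegral.integral_comp_sub_left]
  simp

lemma mconvolution_tailMeasure {ν : Measure ℝ} (hν : ∀ ε : ℝ, 0 < ε → ν (Ioi ε) < ∞)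
    (hN : IsCausalMeasure (tailMeasure ν)) {h : ℝ → X} (hh : IsCausal h) {t : ℝ} (ht : 0 ≤ t) :
    mconvolution (tailMeasure ν) h t = ∫ s in (0 : ℝ)..t, levyTail ν (t - s) • h s := by
  have h1 := intervalIntegral.integral_comp_sub_left (a := 0) (b := t)
    (fun s => levyTail ν (t - s) • h s) t
  simp only [sub_sub_cancel, sub_self, sub_zero] at h1
  rw [← h1, mconvolution_eq_setIntegral hN hh, tailMeasure, restrict_withDensity measurableSet_Icc,
    Measure.restrict_restrict measurableSet_Icc,
    integral_withDensity_eq_integral_toReal_smul (measurable_measure_Ioi ν),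
    intervalIntegral.integral_of_le ht]
  · have : Icc 0 t ∩ Ioi 0 = Ioc 0 t := by
      ext x; simp only [mem_inter_iff, mem_Icc, mem_Ioi, mem_Ioc]
      exact ⟨fun h => ⟨h.2, h.1.2⟩, fun h => ⟨⟨h.1.le, h.2⟩, h.1⟩⟩
    rw [this]
    rfl
  · filter_upwards [ae_restrict_mem (measurableSet_Icc.inter measurableSet_Ioi)] with x hx
    exact hν x hx.2

/-- As `g` is only bounded and measurable, continuity must come from `u`: an `L¹` approximation of
`u` by continuous compactly supported functions gives uniform convergence of the convolutions. -/
lemma continuous_integral_smul_comp_sub {u : ℝ → ℝ} (hu : Integrable u) {g : ℝ → X}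
    (hg : StronglyMeasurable g) {C : ℝ} (hC : ∀ s, ‖g s‖ ≤ C) :
    Continuous fun t => ∫ x, u x • g (t - x) := by
  have hC0 : 0 ≤ C := (norm_nonneg _).trans (hC 0)
  have hint : ∀ {v : ℝ → ℝ}, Integrable v → ∀ t, Integrable fun x => v x • g (t - x) :=
    fun hv t => hv.smul_bdd C (hg.comp_measurable
      (measurable_const.sub measurable_id)).aestronglyMeasurable (Eventually.of_forall fun x => hC _)
  refine continuous_of_uniform_approx_of_continuous fun W hW => ?_
  obtain ⟨ε, hε, hεW⟩ := Metric.mem_uniformity_dist.1 hW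
  obtain ⟨v, hvs, hv, hvc, hvi⟩ := hu.exists_hasCompactSupport_integral_sub_le
    (ε := ε / (2 * (C + 1))) (by positivity)
  refine ⟨fun t => ∫ x, v x • g (t - x), ?_, fun t => hεW ?_⟩
  · have hgl : LocallyIntegrable g := by
      refine (locallyIntegrable_const C).mono hg.aestronglyMeasurable (Eventually.of_forall fun x => ?_)
      rw [Real.norm_of_nonneg hC0]
      exact hC x
    exact hvs.continuous_convolution_left (ContinuousLinearMap.lsmul ℝ ℝ) hvc hgl
  · rw [dist_eq_norm, ← integral_sub (hint hu t) (hint hvi t)]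
    have hs : Integrable fun x => ‖u x - v x‖ := (hu.sub hvi).norm
    calc ‖∫ x, (u x • g (t - x) - v x • g (t - x))‖ ≤ ∫ x, C * ‖u x - v x‖ := by
          refine norm_integral_le_of_norm_le (hs.const_mul C) (Eventually.of_forall fun x => ?_)
          rw [← sub_smul, norm_smul, mul_comm]
          gcongr
          exact hC _
      _ ≤ C * (ε / (2 * (C + 1))) := by
          rw [integral_const_mul]
          gcongr
      _ < ε := by
          rw [mul_div_assoc', div_lt_iff₀ (by positivity)]
          nlinarith

lemma continuous_mconvolution_of_bounded {μ : Measure ℝ} [IsFiniteMeasure μ] (hac : μ ≪ volume)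
    {g : ℝ → X} (hg : StronglyMeasurable g) {C : ℝ} (hC : ∀ s, ‖g s‖ ≤ C) :
    Continuous (mconvolution μ g) := by
  have h := continuous_integral_smul_comp_sub (u := fun x => (μ.rnDeriv volume x).toReal)
    Measure.integrable_toReal_rnDeriv hg hC
  refine h.congr fun t => ?_
  exact integral_rnDeriv_smul hac

/-- By causality, for `t < t₀ + 1` only the parts of `μ` and `g` on `(-∞, t₀ + 1]` contribute, which
reduces to the finite and bounded case. -/
lemma continuous_mconvolution {μ : Measure ℝ} (hμ : IsCausalMeasure μ) (hac : μ ≪ volume)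
    {g : ℝ → X} (hg : IsCausal g) : Continuous (mconvolution μ g) := by
  rw [continuous_iff_continuousAt]
  intro t₀
  obtain ⟨C, hC⟩ := hg.bounded (t₀ + 1)
  have hC0 : 0 ≤ C := (norm_nonneg _).trans (hC _ le_rfl)
  have : IsFiniteMeasure (μ.restrict (Iic (t₀ + 1))) :=
    ⟨by rw [Measure.restrict_apply_univ]; exact hμ.finite _⟩
  have h := continuous_mconvolution_of_bounded (μ := μ.restrict (Iic (t₀ + 1)))
    (Measure.restrict_le_self.absolutelyContinuous.trans hac)
    (hg.stronglyMeasurable.indicator (s := Iic (t₀ + 1)) measurableSet_Iic) (C := C) (fun s => by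
      by_cases hs : s ∈ Iic (t₀ + 1)
      · rw [indicator_of_mem hs]; exact hC s hs
      · rw [indicator_of_notMem hs, norm_zero]; exact hC0)
  refine h.continuousAt.congr ?_
  filter_upwards [Iio_mem_nhds (lt_add_one t₀)] with t (ht : t < t₀ + 1)
  rw [mconvolution_congr hμ (h := g) (k := (Iic (t₀ + 1)).indicator g) fun s hs =>
    (indicator_of_mem (mem_Iic.2 (hs.trans ht.le)) _).symm]
  refine setIntegral_eq_integral_of_forall_compl_eq_zero fun x hx => ?_
  rw [mem_Iic, not_le] at hx
  rw [indicator_apply, hg.eq_zero _ (by linarith), ite_self]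

lemma enorm_mconvolution_le {μ : Measure ℝ} (hμ : IsCausalMeasure μ) {h : ℝ → X}
    (hh : IsCausal h) (t : ℝ) : ‖mconvolution μ h t‖ₑ ≤ ∫⁻ x in Icc 0 t, ‖h (t - x)‖ₑ ∂μ := by
  rw [mconvolution_eq_setIntegral hμ hh]
  exact enorm_integral_le_lintegral_enorm _

omit [NormedSpace ℝ X] in
lemma IsCausal.sub {g k : ℝ → X} (hg : IsCausal g) (hk : IsCausal k) :
    IsCausal fun s => g s - k s := by
  refine ⟨hg.stronglyMeasurable.sub hk.stronglyMeasurable, fun s hs => ?_, fun t => ?_⟩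
  · rw [hg.eq_zero s hs, hk.eq_zero s hs, sub_zero]
  · obtain ⟨C, hC⟩ := hg.bounded t
    obtain ⟨D, hD⟩ := hk.bounded t
    exact ⟨C + D, fun s hs => (norm_sub_le _ _).trans (add_le_add (hC s hs) (hD s hs))⟩

lemma mconvolution_sub {μ : Measure ℝ} (hμ : IsCausalMeasure μ) {g k : ℝ → X} (hg : IsCausal g)
    (hk : IsCausal k) (t : ℝ) :
    mconvolution μ g t - mconvolution μ k t = mconvolution μ (fun s => g s - k s) t :=
  (integral_sub (hg.integrable hμ t) (hk.integrable hμ t)).symm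

/-- Convolution with a measure `U` such that `U ∗ N` is Lebesgue measure inverts the
generalized Caputo primitive. -/
lemma eq_mconvolution_of_mconvolution_eq [CompleteSpace X] {U N : Measure ℝ} (hU : IsCausalMeasure U)
    (hN : IsCausalMeasure N) (hac : U ≪ volume) (hUN : U ∗ N = volume.restrict (Ici (0 : ℝ)))
    {h g : ℝ → X} (hh : IsCausal h) (hhc : Continuous h) (hg : IsCausal g) {T : ℝ} (hT : 0 < T)
    (heq : ∀ t ∈ Icc 0 T, mconvolution N h t = ∫ s in (0 : ℝ)..t, g s) :
    ∀ t ∈ Icc 0 T, h t = mconvolution U g t := by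
  have := hU.sigmaFinite
  have := hN.sigmaFinite
  have hk := continuous_mconvolution hU hac hg
  have hkc : IsCausal (mconvolution U g) := by
    refine ⟨hk.stronglyMeasurable, fun s hs => mconvolution_of_neg hU hg hs, fun t => ?_⟩
    obtain ⟨C, hC⟩ := isCompact_Icc.exists_bound_of_continuousOn (hk.continuousOn (s := Icc 0 t))
    refine ⟨max C 0, fun s hs => ?_⟩
    rcases lt_or_ge s 0 with h0 | h0
    · rw [mconvolution_of_neg hU hg h0, norm_zero]; exact le_max_right _ _
    · exact (hC s ⟨h0, hs⟩).trans (le_max_left _ _)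
  -- Writing `1` for Lebesgue measure on the half-line: `1 ∗ h = U ∗ (N ∗ h) = U ∗ (1 ∗ g) = 1 ∗ (U
  -- ∗ g)`. Both `h` and `U ∗ g` are continuous, so the equality of primitives can be
  -- differentiated.
  have hprim : ∀ t ∈ Icc 0 T, ∫ s in (0 : ℝ)..t, h s = ∫ s in (0 : ℝ)..t, mconvolution U g s := by
    intro t ht
    rw [← mconvolution_volume hh ht.1, ← mconvolution_volume hkc ht.1, ← hUN,
      ← mconvolution_mconvolution hh hU hN, hUN,
      mconvolution_mconvolution hg isCausalMeasure_volume hU, Measure.conv_comm,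
      ← mconvolution_mconvolution hg hU isCausalMeasure_volume]
    refine mconvolution_congr hU fun s hs => ?_
    rcases lt_or_ge s 0 with h0 | h0
    · rw [mconvolution_of_neg hN hh h0, mconvolution_of_neg isCausalMeasure_volume hg h0]
    · rw [heq s ⟨h0, hs.trans ht.2⟩, mconvolution_volume hg h0]
  have hIoo : EqOn h (mconvolution U g) (Ioo 0 T) := by
    intro t ht
    have h1 := intervalIntegral.integral_hasDerivAt_right (hhc.intervalIntegrable 0 t)
      (hhc.stronglyMeasurableAtFilter _ _) hhc.continuousAt
    have h2 := intervalIntegral.integral_hasDerivAt_right (hk.intervalIntegrable 0 t)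
      (hk.stronglyMeasurableAtFilter _ _) hk.continuousAt
    refine h1.unique (h2.congr_of_eventuallyEq ?_)
    filter_upwards [Ioo_mem_nhds ht.1 ht.2] with s hs
    exact hprim s ⟨hs.1.le, hs.2.le⟩
  have hcl := hIoo.closure hhc hk
  rw [closure_Ioo hT.ne] at hcl
  exact hcl

omit [NormedSpace ℝ X] in
lemma IsCausal.intervalIntegrable {g : ℝ → X} (hg : IsCausal g) (a b : ℝ) :
    IntervalIntegrable g volume a b := by
  obtain ⟨C, hC⟩ := hg.bounded (max a b)
  rw [intervalIntegrable_iff]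
  refine Measure.integrableOn_of_bounded (M := C) (by simp [uIoc])
    hg.stronglyMeasurable.aestronglyMeasurable ?_
  filter_upwards [ae_restrict_mem measurableSet_uIoc] with x hx
  exact hC x hx.2

lemma IsCausal.lipschitzOnWith_integral {g : ℝ → X} (hg : IsCausal g) (T : ℝ) :
    ∃ K, LipschitzOnWith K (fun t => ∫ s in (0 : ℝ)..t, g s) (Icc 0 T) := by
  obtain ⟨C, hC⟩ := hg.bounded T
  have hC0 : 0 ≤ C := (norm_nonneg _).trans (hC T le_rfl)
  refine ⟨⟨C, hC0⟩, LipschitzOnWith.of_dist_le_mul fun x hx y hy => ?_⟩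
  rw [dist_eq_norm, intervalIntegral.integral_interval_sub_left (hg.intervalIntegrable _ _)
    (hg.intervalIntegrable _ _), Real.dist_eq]
  refine intervalIntegral.norm_integral_le_of_norm_le_const fun s hs => hC s (hs.2.trans ?_)
  exact max_le hy.2 hx.2

lemma IsCausal.ae_hasDerivAt_integral [CompleteSpace X] {g : ℝ → X} (hg : IsCausal g) {T : ℝ}
    (hT : 0 ≤ T) : ∀ᵐ t ∂(volume.restrict (Icc 0 T)),
      HasDerivAt (fun t => ∫ s in (0 : ℝ)..t, g s) (g t) t := by
  rw [ae_restrict_iff' measurableSet_Icc]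
  filter_upwards [(hg.intervalIntegrable 0 T).ae_hasDerivAt_integral] with t ht htT
  rw [uIcc_of_le hT] at ht
  exact ht htT 0 (left_mem_Icc.2 hT)

/-- Fundamental theorem of calculus for absolutely continuous functions with a bounded
derivative. -/
lemma AbsolutelyContinuousOnInterval.sub_eq_integral [CompleteSpace X] {p g : ℝ → X} {T : ℝ}
    (hT : 0 ≤ T) (hp : AbsolutelyContinuousOnInterval p 0 T)
    (hg : IsCausal g) (hd : ∀ᵐ t ∂(volume.restrict (Icc 0 T)), HasDerivAt p (g t) t) :
    ∀ t ∈ Icc 0 T, p t - p 0 = ∫ s in (0 : ℝ)..t, g s := by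
  have hd' : ∀ᵐ t, t ∈ uIcc 0 T → HasDerivAt (p - fun t => ∫ s in (0 : ℝ)..t, g s) 0 t := by
    rw [uIcc_of_le hT, ← ae_restrict_iff' measurableSet_Icc]
    filter_upwards [hd, hg.ae_hasDerivAt_integral hT] with t h1 h2
    simpa using h1.sub h2
  obtain ⟨K, hK⟩ := hg.lipschitzOnWith_integral T
  rw [← uIcc_of_le hT] at hK
  obtain ⟨c, hc⟩ := AbsolutelyContinuousOnInterval.const_of_ae_hasDerivAt_zero
    (hp.sub hK.absolutelyContinuousOnInterval) hd'
  rw [uIcc_of_le hT] at hc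
  intro t ht
  have h1 := hc t ht
  have h0 := hc 0 (left_mem_Icc.2 hT)
  simp only [Pi.sub_apply, intervalIntegral.integral_same, sub_zero] at h0 h1
  rw [h0, ← h1, sub_sub_cancel]

end

/-! ### The Caputo derivative as an integral equation. -/

section

variable {X : Type*} [NormedAddCommGroup X]

/-- The right-hand side along a curve is controlled only a.e. on `[0, T]`. Cutting it off outside
`S` gives a representative bounded and causal everywhere, to which the convolution lemmas apply. -/
lemma exists_isCausal_ae_eq {g : ℝ → X} {T C : ℝ} (hC : 0 ≤ C)
    (hg : AEStronglyMeasurable g (volume.restrict (Icc 0 T)))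
    (hgC : ∀ᵐ t ∂(volume.restrict (Icc 0 T)), ‖g t‖ ≤ C) :
    ∃ k : ℝ → X, IsCausal k ∧ (∀ s, ‖k s‖ ≤ C) ∧ k =ᵐ[volume.restrict (Icc 0 T)] g := by
  set S : Set ℝ := Icc 0 T ∩ {s | ‖hg.mk g s‖ ≤ C} with hS
  have hmS : MeasurableSet S :=
    measurableSet_Icc.inter (measurableSet_le hg.stronglyMeasurable_mk.norm.measurable measurable_const)
  have hb : ∀ s, ‖S.indicator (hg.mk g) s‖ ≤ C := by
    intro s
    by_cases hs : s ∈ S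
    · rw [indicator_of_mem hs]; exact hs.2
    · rw [indicator_of_notMem hs, norm_zero]; exact hC
  refine ⟨S.indicator (hg.mk g), ⟨hg.stronglyMeasurable_mk.indicator hmS, fun s hs => ?_,
    fun t => ⟨C, fun s _ => hb s⟩⟩, hb, ?_⟩
  · exact indicator_of_notMem (fun h => absurd h.1.1 (not_le.2 hs)) _
  · filter_upwards [hg.ae_eq_mk, hgC, ae_restrict_mem measurableSet_Icc] with s h1 h2 h3
    rw [indicator_of_mem, h1]
    exact ⟨h3, by rw [mem_ofPred_eq, ← h1]; exact h2⟩

/-- A function that is measurable in time and locally Lipschitz in space is measurable along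
continuous curves. -/
lemma aestronglyMeasurable_comp_of_lipschitz {F : ℝ → X → X} {μ : Measure ℝ}
    (hF : ∀ x, AEStronglyMeasurable (fun t => F t x) μ) {r L : ℝ}
    (hL : ∀ᵐ t ∂μ, ∀ x ∈ Metric.ball (0 : X) r, ∀ z ∈ Metric.ball (0 : X) r,
      ‖F t x - F t z‖ ≤ L * ‖x - z‖) {f : ℝ → X} (hf : Continuous f)
    (hfr : ∀ t, f t ∈ Metric.ball (0 : X) r) : AEStronglyMeasurable (fun t => F t (f t)) μ := by
  -- Sampling the curve on a grid makes the space argument constant on countably many pieces, where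
  -- measurability of `F(·, x)` for fixed `x` is enough.
  have hstep : ∀ n : ℕ, AEStronglyMeasurable
      (fun t => F t (f (⌊((n : ℝ) + 1) * t⌋ / ((n : ℝ) + 1)))) μ := by
    intro n
    have hk : Measurable fun t : ℝ => ⌊((n : ℝ) + 1) * t⌋ := Int.measurable_floor.comp (by fun_prop)
    have hcov : (⋃ k : ℤ, (fun t : ℝ => ⌊((n : ℝ) + 1) * t⌋) ⁻¹' {k}) = univ := by
      ext t; simp
    rw [← Measure.restrict_univ (μ := μ), ← hcov, aestronglyMeasurable_iUnion_iff]
    intro k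
    refine ((hF (f (k / ((n : ℝ) + 1)))).restrict (s := _)).congr ?_
    filter_upwards [ae_restrict_mem (hk (measurableSet_singleton k))] with t ht
    have ht : ⌊((n : ℝ) + 1) * t⌋ = k := ht
    rw [ht]
  refine aestronglyMeasurable_of_tendsto_ae atTop hstep ?_
  filter_upwards [hL] with t ht
  have hlim : Tendsto (fun n : ℕ => (⌊((n : ℝ) + 1) * t⌋ : ℝ) / ((n : ℝ) + 1)) atTop (𝓝 t) := by
    have h1 : Tendsto (fun n : ℕ => t - 1 / ((n : ℝ) + 1)) atTop (𝓝 t) := by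
      simpa using tendsto_const_nhds.sub (tendsto_one_div_add_atTop_nhds_zero_nat (𝕜 := ℝ))
    refine tendsto_of_tendsto_of_tendsto_of_le_of_le h1 tendsto_const_nhds (fun n => ?_) fun n => ?_
    · have hn : (0 : ℝ) < n + 1 := by positivity
      have := Int.sub_one_lt_floor (((n : ℝ) + 1) * t)
      show t - 1 / ((n : ℝ) + 1) ≤ _
      rw [le_div_iff₀ hn, sub_mul, one_div, inv_mul_cancel₀ hn.ne']
      linarith
    · have hn : (0 : ℝ) < n + 1 := by positivity
      show _ / _ ≤ t
      rw [div_le_iff₀ hn, mul_comm t]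
      exact Int.floor_le _
  have hlim2 := (hf.tendsto t).comp hlim
  rw [tendsto_iff_norm_sub_tendsto_zero] at hlim2 ⊢
  refine squeeze_zero (fun n => norm_nonneg _) (fun n => ht _ (hfr _) _ (hfr _)) ?_
  simpa using hlim2.const_mul L

lemma isCausal_sub_of_continuous {f : ℝ → X} (hf : Continuous f) (hf0 : ∀ s ≤ 0, f s = f 0) :
    IsCausal fun s => f s - f 0 := by
  refine ⟨hf.stronglyMeasurable.sub stronglyMeasurable_const, fun s hs => ?_, fun t => ?_⟩
  · rw [hf0 s hs.le, sub_self]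
  · obtain ⟨C, hC⟩ := isCompact_Icc.exists_bound_of_continuousOn
      ((hf.sub continuous_const).continuousOn (s := Icc 0 t) (f := fun s => f s - f 0))
    refine ⟨max C 0, fun s hs => ?_⟩
    rcases lt_or_ge s 0 with h0 | h0
    · rw [hf0 s h0.le, sub_self, norm_zero]; exact le_max_right _ _
    · exact (hC s ⟨h0, hs⟩).trans (le_max_left _ _)

variable [NormedSpace ℝ X]

/-- A continuous function has generalized Caputo derivative `g` iff its increment is the
convolution of `g` with the potential measure. -/
theorem hasCaputoDerivOn_iff [CompleteSpace X] {U ν : Measure ℝ} (hU : IsCausalMeasure U)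
    (hN : IsCausalMeasure (tailMeasure ν)) (hν : ∀ ε : ℝ, 0 < ε → ν (Ioi ε) < ∞)
    (hac : U ≪ volume) (hUN : U ∗ tailMeasure ν = volume.restrict (Ici (0 : ℝ)))
    {f g k : ℝ → X} (hf : Continuous f) (hf0 : ∀ s ≤ 0, f s = f 0) {T : ℝ} (hT : 0 < T)
    (hk : IsCausal k) (hkg : k =ᵐ[volume.restrict (Icc 0 T)] g) :
    HasCaputoDerivOn ν T f g ↔ ∀ t ∈ Icc 0 T, f t - f 0 = mconvolution U k t := by
  have hh := isCausal_sub_of_continuous hf hf0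
  have hprim : ∀ t, 0 ≤ t → caputoPrimitive ν f t =
      mconvolution (tailMeasure ν) (fun s => f s - f 0) t := fun t ht =>
    (mconvolution_tailMeasure hν hN hh ht).symm
  constructor
  · intro h
    refine eq_mconvolution_of_mconvolution_eq hU hN hac hUN hh (hf.sub continuous_const) hk hT ?_
    intro t ht
    have hd : ∀ᵐ t ∂(volume.restrict (Icc (0 : ℝ) T)),
        HasDerivAt (caputoPrimitive ν f) (k t) t := by
      filter_upwards [h.ae_hasDerivAt, hkg] with t h1 h2
      rwa [h2]
    rw [← hprim t ht.1, ← AbsolutelyContinuousOnInterval.sub_eq_integral hT.le h.absCont hk hd t ht]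
    simp [caputoPrimitive]
  · intro h
    have := hU.sigmaFinite
    have := hN.sigmaFinite
    have heq : EqOn (caputoPrimitive ν f) (fun t => ∫ s in (0 : ℝ)..t, k s) (Icc 0 T) := by
      intro t ht
      simp only
      rw [hprim t ht.1, ← mconvolution_volume hk ht.1, ← hUN, Measure.conv_comm,
        ← mconvolution_mconvolution hk hN hU]
      refine mconvolution_congr hN fun s hs => ?_
      rcases lt_or_ge s 0 with h0 | h0
      · rw [mconvolution_of_neg hU hk h0, hf0 s h0.le, sub_self]
      · exact h s ⟨h0, hs.trans ht.2⟩
    refine ⟨?_, ?_⟩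
    · obtain ⟨K, hK⟩ := hk.lipschitzOnWith_integral T
      refine LipschitzOnWith.absolutelyContinuousOnInterval (K := K) ?_
      rw [uIcc_of_le hT.le]
      intro x hx y hy
      rw [heq hx, heq hy]
      exact hK hx hy
    -- The primitive is identified only on `[0, T]`; a two-sided derivative needs a neighbourhood
    -- inside it, so the endpoints are discarded.
    · have hIoo : ∀ᵐ t ∂(volume.restrict (Icc (0 : ℝ) T)), t ∈ Ioo 0 T := by
        rw [restrict_Ioo_eq_restrict_Icc.symm]
        exact ae_restrict_mem measurableSet_Ioo
      filter_upwards [hk.ae_hasDerivAt_integral hT.le, hkg, hIoo] with t h1 h2 h3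
      rw [← h2]
      refine h1.congr_of_eventuallyEq ?_
      filter_upwards [Ioo_mem_nhds h3.1 h3.2] with s hs
      exact heq ⟨hs.1.le, hs.2.le⟩

end

/-! ### Picard iteration. -/

section

variable {X : Type*} [NormedAddCommGroup X]

/-- Reflection preserves Lebesgue-null sets, and these are `U`-null. Without absolute continuity an
a.e. bound on the integrand would say nothing under `U`. -/
lemma ae_restrict_comp_sub {U : Measure ℝ} (hac : U ≪ volume) {p : ℝ → Prop} {T t : ℝ}
    (ht : t ≤ T) (hp : ∀ᵐ s ∂(volume.restrict (Icc 0 T)), p s) :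
    ∀ᵐ x ∂(U.restrict (Icc 0 t)), p (t - x) := by
  rw [ae_restrict_iff' measurableSet_Icc] at hp ⊢
  filter_upwards [hac.ae_le ((Measure.measurePreserving_sub_left volume t).quasiMeasurePreserving.ae hp)]
    with x hx hxt
  exact hx ⟨sub_nonneg.2 hxt.2, (sub_le_self t hxt.1).trans ht⟩

lemma LipschitzConstOn.mono_time {F : ℝ → X → X} {T T' r L : ℝ} (h : LipschitzConstOn T F r L)
    (hT : T' ≤ T) : LipschitzConstOn T' F r L :=
  ae_mono (Measure.restrict_mono_set _ (Icc_subset_Icc_right hT)) h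

lemma exists_isCausal_comp {F : ℝ → X → X} {T r C L : ℝ} (hT : 0 ≤ T) (hC : 0 ≤ C)
    (hF : ∀ x, AEStronglyMeasurable (fun t => F t x) (volume.restrict (Icc (0 : ℝ) T)))
    (hFC : ∀ᵐ t ∂(volume.restrict (Icc (0 : ℝ) T)), ∀ x ∈ Metric.ball (0 : X) r, ‖F t x‖ ≤ C)
    (hL : LipschitzConstOn T F r L) (f : C(Icc (0 : ℝ) T, X))
    (hf : ∀ t, f t ∈ Metric.ball (0 : X) r) :
    ∃ k : ℝ → X, IsCausal k ∧ (∀ s, ‖k s‖ ≤ C) ∧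
      k =ᵐ[volume.restrict (Icc 0 T)] fun t => F t (IccExtend hT f t) :=
  exists_isCausal_ae_eq hC
    (aestronglyMeasurable_comp_of_lipschitz hF hL f.continuous.Icc_extend' fun _ => hf _)
    (hFC.mono fun _ ht => ht _ (hf _))

variable [NormedSpace ℝ X]

lemma enorm_mconvolution_sub_le {U : Measure ℝ} (hU : IsCausalMeasure U) (hac : U ≪ volume)
    {k₁ k₂ : ℝ → X} (h₁ : IsCausal k₁) (h₂ : IsCausal k₂) {D : ℝ → ℝ≥0∞} {T t : ℝ}
    (ht : t ≤ T) (hD : ∀ᵐ s ∂(volume.restrict (Icc 0 T)), ‖k₁ s - k₂ s‖ₑ ≤ D s) :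
    ‖mconvolution U k₁ t - mconvolution U k₂ t‖ₑ ≤ ∫⁻ x in Icc 0 t, D (t - x) ∂U := by
  rw [mconvolution_sub hU h₁ h₂]
  exact (enorm_mconvolution_le hU (h₁.sub h₂) t).trans
    (lintegral_mono_ae (ae_restrict_comp_sub hac ht hD))

lemma norm_mconvolution_sub_le {U : Measure ℝ} (hU : IsCausalMeasure U) (hac : U ≪ volume)
    {k₁ k₂ : ℝ → X} (h₁ : IsCausal k₁) (h₂ : IsCausal k₂) {D η T t : ℝ} (hD0 : 0 ≤ D) (hη : 0 ≤ η)
    (ht : t ≤ T) (hD : ∀ᵐ s ∂(volume.restrict (Icc 0 T)), ‖k₁ s - k₂ s‖ ≤ D)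
    (hUη : U (Iic T) ≤ ENNReal.ofReal η) :
    ‖mconvolution U k₁ t - mconvolution U k₂ t‖ ≤ D * η := by
  have h := enorm_mconvolution_sub_le hU hac h₁ h₂ (D := fun _ => ENNReal.ofReal D) ht
    (hD.mono fun s hs => by rw [← ofReal_norm]; exact ENNReal.ofReal_le_ofReal hs)
  rw [setLIntegral_const, ← ofReal_norm] at h
  refine (ENNReal.ofReal_le_ofReal_iff (by positivity)).1 (h.trans ?_)
  rw [ENNReal.ofReal_mul hD0]
  gcongr
  exact (measure_mono fun x hx => hx.2.trans ht).trans hUη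

lemma mconvolution_zero {U : Measure ℝ} (hU : IsCausalMeasure U) (hac : U ≪ volume) {k : ℝ → X}
    (hk : IsCausal k) : mconvolution U k 0 = 0 := by
  rw [mconvolution_eq_setIntegral hU hk, Icc_self, Measure.restrict_eq_zero.2 (hac (by simp)),
    integral_zero_measure]

/-- The Cauchy problem is equivalent to an integral equation. -/
theorem isCauchySolution_iff [CompleteSpace X] {U ν : Measure ℝ} (hU : IsCausalMeasure U)
    (hN : IsCausalMeasure (tailMeasure ν)) (hν : ∀ ε : ℝ, 0 < ε → ν (Ioi ε) < ∞)
    (hac : U ≪ volume) (hUN : U ∗ tailMeasure ν = volume.restrict (Ici (0 : ℝ)))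
    {F : ℝ → X → X} {T : ℝ} (hT : 0 < T) {R : ℝ} {x₀ : X} {f : C(Icc (0 : ℝ) T, X)} {k : ℝ → X}
    (hk : IsCausal k)
    (hkF : k =ᵐ[volume.restrict (Icc 0 T)] fun t => F t (IccExtend hT.le f t)) :
    IsCauchySolution ν F hT.le R x₀ f ↔ (∀ t, f t ∈ Metric.ball x₀ R) ∧
      ∀ t : Icc (0 : ℝ) T, f t = x₀ + mconvolution U k t := by
  have h0 : IccExtend hT.le f 0 = f ⟨0, left_mem_Icc.2 hT.le⟩ :=
    IccExtend_of_mem hT.le f (left_mem_Icc.2 hT.le)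
  have hf0 : ∀ s ≤ 0, IccExtend hT.le f s = IccExtend hT.le f 0 := by
    intro s hs
    rw [h0, IccExtend_of_le_left _ _ hs]
  have key := hasCaputoDerivOn_iff hU hN hν hac hUN (f := IccExtend hT.le f)
    f.continuous.Icc_extend' hf0 hT hk hkF
  constructor
  · intro h
    refine ⟨h.mem_ball, fun t => ?_⟩
    rw [← key.1 h.eqn t t.2, h0, h.init, IccExtend_of_mem hT.le f t.2, add_sub_cancel]
  · rintro ⟨h1, h2⟩
    have hinit : f ⟨0, left_mem_Icc.2 hT.le⟩ = x₀ := by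
      rw [h2]
      simp [mconvolution_zero hU hac hk]
    refine ⟨h1, hinit, key.2 fun t ht => ?_⟩
    rw [h0, hinit, IccExtend_of_mem hT.le f ht, h2, add_sub_cancel_left]

/-- With `T' = 1/z` the Chernoff bound reads `U[0, 1/z] ≤ e/Φ(z)`, which tends to `0`. -/
lemma exists_measure_Iic_le {U : Measure ℝ} {Φ : ℝ → ℝ} (hΦ : Tendsto Φ atTop atTop)
    (hU : ∀ z, 0 < z → laplace U z = ENNReal.ofReal (Φ z)⁻¹) {T η : ℝ} (hT : 0 < T) (hη : 0 < η) :
    ∃ T', 0 < T' ∧ T' ≤ T ∧ U (Iic T') ≤ ENNReal.ofReal η := by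
  obtain ⟨z, hz1, hz2⟩ := ((hΦ.eventually_ge_atTop (Real.exp 1 / η)).and
    (eventually_ge_atTop T⁻¹)).exists
  have hz : 0 < z := (inv_pos.2 hT).trans_le hz2
  refine ⟨z⁻¹, inv_pos.2 hz, (inv_le_comm₀ hz hT).2 hz2, ?_⟩
  refine (measure_Iic_le_laplace U hz.le z⁻¹).trans ?_
  have hpos : 0 < Φ z := (by positivity : 0 < Real.exp 1 / η).trans_le hz1
  rw [hU z hz, mul_inv_cancel₀ hz.ne', ← ENNReal.ofReal_mul (by positivity)]
  refine ENNReal.ofReal_le_ofReal ?_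
  rw [← div_eq_mul_inv, div_le_iff₀ hpos]
  rwa [div_le_iff₀ hη, mul_comm] at hz1

/-- Picard iteration for the integral equation `f = x₀ + U ⋆ F(·, f)`. -/
theorem exists_integral_solution [CompleteSpace X] {U : Measure ℝ} (hU : IsCausalMeasure U)
    (hac : U ≪ volume) {F : ℝ → X → X} {T r C L η ρ : ℝ} (hT : 0 ≤ T) (hC : 0 ≤ C) (hL0 : 0 ≤ L)
    (hρ : 0 ≤ ρ) (hη : 0 ≤ η)
    (hF : ∀ x, AEStronglyMeasurable (fun t => F t x) (volume.restrict (Icc (0 : ℝ) T)))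
    (hFC : ∀ᵐ t ∂(volume.restrict (Icc (0 : ℝ) T)), ∀ x ∈ Metric.ball (0 : X) r, ‖F t x‖ ≤ C)
    (hL : LipschitzConstOn T F r L) {x₀ : X} (hx₀ : Metric.closedBall x₀ ρ ⊆ Metric.ball 0 r)
    (hUη : U (Iic T) ≤ ENNReal.ofReal η) (hCη : C * η ≤ ρ) (hLη : L * η ≤ 1 / 2) :
    ∃ (f : C(Icc (0 : ℝ) T, X)) (k : ℝ → X), (∀ t, f t ∈ Metric.closedBall x₀ ρ) ∧ IsCausal k ∧
      (k =ᵐ[volume.restrict (Icc 0 T)] fun t => F t (IccExtend hT f t)) ∧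
      ∀ t : Icc (0 : ℝ) T, f t = x₀ + mconvolution U k t := by
  classical
  set S : Set C(Icc (0 : ℝ) T, X) := Metric.closedBall (ContinuousMap.const _ x₀) ρ with hS
  have hSmem : ∀ f, f ∈ S ↔ ∀ t, f t ∈ Metric.closedBall x₀ ρ := by
    intro f
    rw [hS, Metric.mem_closedBall, ContinuousMap.dist_le hρ]
    rfl
  have hex : ∀ f : C(Icc (0 : ℝ) T, X), f ∈ S → ∃ k : ℝ → X, IsCausal k ∧ (∀ s, ‖k s‖ ≤ C) ∧
      k =ᵐ[volume.restrict (Icc 0 T)] fun t => F t (IccExtend hT f t) := fun f hf =>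
    exists_isCausal_comp hT hC hF hFC hL f fun t => hx₀ ((hSmem f).1 hf t)
  choose! k hkc hkC hkF using hex
  have hz : IsCausal (0 : ℝ → X) :=
    ⟨stronglyMeasurable_zero, fun _ _ => rfl, fun _ => ⟨0, fun _ _ => by simp⟩⟩
  -- The Picard map. Off the closed ball `S` no integrable right-hand side is guaranteed, and the
  -- identity serves as a dummy value.
  set G : C(Icc (0 : ℝ) T, X) → C(Icc (0 : ℝ) T, X) := fun f =>
    if hf : f ∈ S then ⟨fun t => x₀ + mconvolution U (k f) t,
      continuous_const.add ((continuous_mconvolution hU hac (hkc f hf)).comp continuous_subtype_val)⟩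
    else f with hG
  have hGapp : ∀ f ∈ S, ∀ t : Icc (0 : ℝ) T, G f t = x₀ + mconvolution U (k f) t := by
    intro f hf t
    simp only [hG, dif_pos hf]
    rfl
  have hmaps : MapsTo G S S := by
    intro f hf
    rw [hSmem]
    intro t
    rw [hGapp f hf, Metric.mem_closedBall, dist_eq_norm, add_sub_cancel_left]
    have h := norm_mconvolution_sub_le hU hac (hkc f hf) hz hC hη t.2.2
      (Eventually.of_forall fun s => by simpa using hkC f hf s) hUη
    have h0 : mconvolution U (0 : ℝ → X) t = 0 := by simp [mconvolution]
    rw [h0, sub_zero] at h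
    exact h.trans hCη
  have hcontr : ContractingWith (1 / 2) (hmaps.restrict G S S) := by
    refine ⟨by norm_num, LipschitzWith.of_dist_le_mul fun f g => ?_⟩
    obtain ⟨f, hf⟩ := f
    obtain ⟨g, hg⟩ := g
    change dist (G f) (G g) ≤ _ * dist f g
    rw [ContinuousMap.dist_le (by positivity)]
    intro t
    rw [hGapp f hf, hGapp g hg, dist_add_left, dist_eq_norm]
    have hD : ∀ᵐ s ∂(volume.restrict (Icc 0 T)), ‖k f s - k g s‖ ≤ L * dist f g := by
      filter_upwards [hkF f hf, hkF g hg, hL] with s h1 h2 h3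
      rw [h1, h2]
      refine (h3 _ (hx₀ ((hSmem f).1 hf _)) _ (hx₀ ((hSmem g).1 hg _))).trans ?_
      gcongr
      rw [← dist_eq_norm]
      exact ContinuousMap.dist_apply_le_dist _
    refine (norm_mconvolution_sub_le hU hac (hkc f hf) (hkc g hg) (by positivity) hη t.2.2 hD
      hUη).trans ?_
    have : L * η * dist f g ≤ 1 / 2 * dist f g := by gcongr
    push_cast
    linarith
  obtain ⟨f, hfS, hfix, -⟩ := hcontr.exists_fixedPoint' (Metric.isClosed_closedBall.isComplete) hmaps
    (x := ContinuousMap.const _ x₀) (Metric.mem_closedBall_self hρ) (edist_ne_top _ _)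
  refine ⟨f, k f, (hSmem f).1 hfS, hkc f hfS, hkF f hfS, fun t => ?_⟩
  conv_lhs => rw [← hfix.eq]
  exact hGapp f hfS t

end

/-! ### Existence, uniqueness and dependence on the datum. -/

section

variable {X : Type*} [NormedAddCommGroup X]

/-- One ball about the origin contains the values of all solutions concerned, so a single pair of
constants from (A1) and (A2) serves every datum. -/
lemma ball_subset_ball_of_mem {f₀ x₀ : X} {R : ℝ} (hx₀ : x₀ ∈ Metric.ball f₀ 1) :
    Metric.ball x₀ R ⊆ Metric.ball 0 (R + 1 + ‖f₀‖) := by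
  refine Metric.ball_subset_ball' ?_
  have h1 : dist x₀ f₀ < 1 := hx₀
  have h2 := dist_triangle x₀ f₀ 0
  rw [dist_zero_right f₀] at h2
  linarith

variable [NormedSpace ℝ X] [CompleteSpace X] {Ω : Type*} [MeasurableSpace Ω] {P : Measure Ω}
  [IsProbabilityMeasure P] {Φ : ℝ → ℝ} {ν : Measure ℝ} {σ : ℝ≥0 → Ω → ℝ}

/-- Lipschitz dependence of solutions of the Cauchy problem on the initial datum. -/
theorem IsCauchySolution.enorm_sub_le (hΦ : IsSpecialBernstein Φ) (hν : IsLevyTriple Φ 0 0 ν)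
    (htop : Tendsto Φ atTop atTop) (hσ : IsSubordinator P σ) (hσΦ : HasLaplaceExponent P σ Φ)
    {F : ℝ → X → X} {T r C l R : ℝ} (hT : 0 < T) (hC : 0 ≤ C) (hl : 0 < l)
    (hF : ∀ x, AEStronglyMeasurable (fun t => F t x) (volume.restrict (Icc (0 : ℝ) T)))
    (hFC : ∀ᵐ t ∂(volume.restrict (Icc (0 : ℝ) T)), ∀ x ∈ Metric.ball (0 : X) r, ‖F t x‖ ≤ C)
    (hL : LipschitzConstOn T F r l) {x₁ x₂ : X} {f₁ f₂ : C(Icc (0 : ℝ) T, X)}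
    (h₁ : IsCauchySolution ν F hT.le R x₁ f₁) (h₂ : IsCauchySolution ν F hT.le R x₂ f₂)
    (hr₁ : Metric.ball x₁ R ⊆ Metric.ball 0 r) (hr₂ : Metric.ball x₂ R ⊆ Metric.ball 0 r)
    (t : Icc (0 : ℝ) T) :
    ‖f₁ t - f₂ t‖ₑ ≤ ‖x₁ - x₂‖ₑ * (1 + ENNReal.ofReal l * expPotential P σ l (Iic (t : ℝ))) := by
  have hU : IsCausalMeasure (potentialMeasure P σ) :=
    isCausalMeasure_of_laplace (potentialMeasure_Iio hσ) zero_le_one (z := 1) (by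
      rw [laplace_potentialMeasure hσ hσΦ hΦ one_pos]; exact ENNReal.ofReal_lt_top)
  have hN : IsCausalMeasure (tailMeasure ν) :=
    isCausalMeasure_of_laplace (tailMeasure_Iio ν) zero_le_one (z := 1) (by
      rw [hν.laplace_tailMeasure one_pos]; exact ENNReal.ofReal_lt_top)
  have hac := potentialMeasure_absolutelyContinuous hσ hσΦ hΦ htop
  have hUN := potentialMeasure_conv_tailMeasure hσ hσΦ hΦ hν
  obtain ⟨k₁, hk₁, -, hkF₁⟩ := exists_isCausal_comp hT.le hC hF hFC hL f₁ fun t => hr₁ (h₁.mem_ball t)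
  obtain ⟨k₂, hk₂, -, hkF₂⟩ := exists_isCausal_comp hT.le hC hF hFC hL f₂ fun t => hr₂ (h₂.mem_ball t)
  have e₁ := ((isCauchySolution_iff hU hN (fun ε hε => hν.measure_Ioi_lt_top hε) hac hUN hT hk₁
    hkF₁).1 h₁).2
  have e₂ := ((isCauchySolution_iff hU hN (fun ε hε => hν.measure_Ioi_lt_top hε) hac hUN hT hk₂
    hkF₂).1 h₂).2
  set m : ℝ → ℝ≥0∞ := fun s => ‖IccExtend hT.le f₁ s - IccExtend hT.le f₂ s‖ₑ with hm
  have hD : ∀ᵐ s ∂(volume.restrict (Icc 0 T)), ‖k₁ s - k₂ s‖ₑ ≤ ENNReal.ofReal l * m s := by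
    filter_upwards [hkF₁, hkF₂, hL] with s a₁ a₂ a₃
    rw [a₁, a₂, hm]
    simp only
    rw [← ofReal_norm, ← ofReal_norm, ← ENNReal.ofReal_mul hl.le]
    exact ENNReal.ofReal_le_ofReal (a₃ _ (hr₁ (h₁.mem_ball _)) _ (hr₂ (h₂.mem_ball _)))
  -- Grönwall is applied to the pointwise distance, bounded a priori by the sup norm of `f₁ - f₂`.
  have key := gronwall_potentialMeasure hσ hσΦ hΦ htop hl (T := T) (m := m) (a := ‖x₁ - x₂‖ₑ)
    (B := ‖f₁ - f₂‖ₑ) enorm_ne_top (fun s hs => by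
      simp only [hm]
      rw [← ofReal_norm, ← ofReal_norm]
      exact ENNReal.ofReal_le_ofReal ((f₁ - f₂).norm_coe_le_norm _)) (fun s hs => by
      have hms : m s = ‖f₁ ⟨s, hs⟩ - f₂ ⟨s, hs⟩‖ₑ := by
        simp only [hm]
        rw [IccExtend_of_mem hT.le f₁ hs, IccExtend_of_mem hT.le f₂ hs]
      rw [hms, e₁, e₂, add_sub_add_comm, ← lintegral_const_mul' _ _ ENNReal.ofReal_ne_top]
      exact (enorm_add_le _ _).trans (by
        gcongr
        exact enorm_mconvolution_sub_le hU hac hk₁ hk₂ hs.2 hD)) t t.2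
  simpa only [hm, IccExtend_of_mem hT.le f₁ t.2, IccExtend_of_mem hT.le f₂ t.2] using key

/-- Local existence and uniqueness for the Cauchy problem, uniformly in the initial datum. -/
theorem exists_isCommonExistenceTime (hΦ : IsSpecialBernstein Φ) (hν : IsLevyTriple Φ 0 0 ν)
    (htop : Tendsto Φ atTop atTop) (hσ : IsSubordinator P σ) (hσΦ : HasLaplaceExponent P σ Φ)
    {T : ℝ} (hT : 0 < T) {F : ℝ → X → X}
    (hF : ∀ x, AEStronglyMeasurable (fun t => F t x) (volume.restrict (Icc (0 : ℝ) T)))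
    (hA1 : LocallyBoundedOn T F) (hA2 : ∀ R : ℝ, ∃ L : ℝ, 0 < L ∧ LipschitzConstOn T F R L)
    (f₀ : X) {R : ℝ} (hR : 0 < R) :
    ∃ (T' : ℝ) (hT' : 0 < T'), T' ≤ T ∧ IsCommonExistenceTime ν F hT'.le R f₀ := by
  have hU : IsCausalMeasure (potentialMeasure P σ) :=
    isCausalMeasure_of_laplace (potentialMeasure_Iio hσ) zero_le_one (z := 1) (by
      rw [laplace_potentialMeasure hσ hσΦ hΦ one_pos]; exact ENNReal.ofReal_lt_top)
  have hN : IsCausalMeasure (tailMeasure ν) :=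
    isCausalMeasure_of_laplace (tailMeasure_Iio ν) zero_le_one (z := 1) (by
      rw [hν.laplace_tailMeasure one_pos]; exact ENNReal.ofReal_lt_top)
  have hac := potentialMeasure_absolutelyContinuous hσ hσΦ hΦ htop
  have hUN := potentialMeasure_conv_tailMeasure hσ hσΦ hΦ hν
  obtain ⟨C, hC, hFC⟩ := hA1 (R + 1 + ‖f₀‖)
  obtain ⟨L, hL0, hL⟩ := hA2 (R + 1 + ‖f₀‖)
  -- `C η ≤ R/2` keeps the iterates in the closed ball of radius `R/2`, hence strictly inside the
  -- open ball of radius `R`; `L η ≤ 1/2` gives the contraction.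
  set η : ℝ := min (R / 2 / C) (1 / 2 / L) with hη
  have hη0 : 0 < η := by positivity
  obtain ⟨T', hT', hT'T, hUη⟩ := exists_measure_Iic_le htop
    (fun z hz => laplace_potentialMeasure hσ hσΦ hΦ hz) hT hη0
  have hsub : volume.restrict (Icc (0 : ℝ) T') ≤ volume.restrict (Icc 0 T) :=
    Measure.restrict_mono_set _ (Icc_subset_Icc_right hT'T)
  have hF' := fun x => (hF x).mono_measure hsub
  have hFC' := ae_mono hsub hFC
  have hL' := hL.mono_time hT'T
  refine ⟨T', hT', hT'T, fun x₀ hx₀ => ?_⟩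
  have hball := ball_subset_ball_of_mem (R := R) hx₀
  have hcl : Metric.closedBall x₀ (R / 2) ⊆ Metric.ball x₀ R :=
    Metric.closedBall_subset_ball (by linarith)
  obtain ⟨f, k, hfb, hk, hkF, hfe⟩ := exists_integral_solution hU hac hT'.le hC.le hL0.le
    (half_pos hR).le hη0.le hF' hFC' hL' (hcl.trans hball) hUη
    (by rw [mul_comm, ← le_div_iff₀ hC]; exact min_le_left _ _)
    (by rw [mul_comm, ← le_div_iff₀ hL0]; exact min_le_right _ _)
  have hsol : IsCauchySolution ν F hT'.le R x₀ f :=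
    (isCauchySolution_iff hU hN (fun ε hε => hν.measure_Ioi_lt_top hε) hac hUN hT' hk hkF).2
      ⟨fun t => hcl (hfb t), hfe⟩
  refine ⟨f, hsol, fun g hg => ContinuousMap.ext fun t => ?_⟩
  -- Uniqueness must hold in the whole ball of radius `R`, beyond the ball where the iteration runs;
  -- the stability estimate with equal data provides it.
  have h := hg.enorm_sub_le hΦ hν htop hσ hσΦ hT' hC.le hL0 hF' hFC' hL' hsol hball hball t
  rwa [sub_self, enorm_zero, zero_mul, nonpos_iff_eq_zero, enorm_eq_zero, sub_eq_zero] at h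

end

/-! ### Identification of `𝔢_Φ` and the main theorem. -/

section

variable {Ω : Type*} [MeasurableSpace Ω] {P : Measure Ω} [IsProbabilityMeasure P]
  {Φ : ℝ → ℝ} {σ : ℝ≥0 → Ω → ℝ}

lemma integrable_exp_inverseSubordinator (hΦ : IsSpecialBernstein Φ)
    (htop : Tendsto Φ atTop atTop) (hσ : IsSubordinator P σ) (hσΦ : HasLaplaceExponent P σ Φ)
    {l : ℝ} (hl : 0 < l) (t : ℝ) :
    Integrable (fun ω => Real.exp (l * (inverseSubordinator σ t ω : ℝ))) P := by
  refine ⟨(hσ.aemeasurable_exp_inverseSubordinator hσΦ (hΦ.pos one_pos) hl t).aestronglyMeasurable,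
    ?_⟩
  rw [hasFiniteIntegral_iff_ofReal (Eventually.of_forall fun ω => by positivity),
    hσ.lintegral_exp_inverseSubordinator hσΦ (hΦ.pos one_pos) hl t]
  exact ENNReal.add_lt_top.2 ⟨ENNReal.one_lt_top, ENNReal.mul_lt_top ENNReal.ofReal_lt_top
    (expPotential_Iic_lt_top hσ hσΦ htop l t)⟩

lemma ofReal_phiExp (hΦ : IsSpecialBernstein Φ)
    (htop : Tendsto Φ atTop atTop) (hσ : IsSubordinator P σ) (hσΦ : HasLaplaceExponent P σ Φ)
    {l : ℝ} (hl : 0 < l) (t : ℝ) :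
    ENNReal.ofReal (phiExp P σ t l) = 1 + ENNReal.ofReal l * expPotential P σ l (Iic t) := by
  rw [phiExp, ofReal_integral_eq_lintegral_ofReal
    (integrable_exp_inverseSubordinator hΦ htop hσ hσΦ hl t)
    (Eventually.of_forall fun ω => by positivity),
    hσ.lintegral_exp_inverseSubordinator hσΦ (hΦ.pos one_pos) hl t]

end

/-- Finiteness of `𝔢_Φ(T'; L)` is expressed by integrability, since the Bochner integral in `phiExp`
would default to `0` otherwise. -/
theorem mainTheorem6
    {X : Type*} [NormedAddCommGroup X] [NormedSpace ℝ X] [CompleteSpace X]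
    {Ω : Type*} [MeasurableSpace Ω] (P : Measure Ω) [IsProbabilityMeasure P]
    -- a special Bernstein function with Lévy triple `(0, 0, ν)`, `ν(0, ∞) = ∞`
    (Φ : ℝ → ℝ) (hΦ : IsSpecialBernstein Φ)
    (ν : Measure ℝ) (hν : IsLevyTriple Φ 0 0 ν) (hν_top : ν (Ioi 0) = ∞)
    -- the subordinator with Laplace exponent `Φ`
    (σ : ℝ≥0 → Ω → ℝ) (hσ : IsSubordinator P σ) (hσΦ : HasLaplaceExponent P σ Φ)
    -- the bound `u(t) ≤ C t ^ (β - 1)` near `0` on the potential density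
    (t₀ C β : ℝ) (ht₀ : 0 < t₀) (hC : 0 < C) (hβ : β ∈ Ioo (0 : ℝ) 1)
    (hu : ∀ᵐ t ∂(volume.restrict (Ioo (0 : ℝ) t₀)),
      potentialDensity P σ t ≤ ENNReal.ofReal (C * t ^ (β - 1)))
    -- the right-hand side `F : [0, T] × X → X`
    (T : ℝ) (hT : 0 < T) (F : ℝ → X → X)
    (hF_meas : ∀ x, AEStronglyMeasurable (fun t => F t x) (volume.restrict (Icc (0 : ℝ) T)))
    (hA1 : LocallyBoundedOn T F)
    (hA2 : ∀ R : ℝ, ∃ L : ℝ, 0 < L ∧ LipschitzConstOn T F R L)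
    (f₀ : X) (R : ℝ) (hR : 0 < R) :
    (∃ (T' : ℝ) (hT' : 0 < T'), T' ≤ T ∧ IsCommonExistenceTime ν F hT'.le R f₀) ∧
    ∀ (T' : ℝ) (hT' : 0 < T'), T' ≤ T → IsCommonExistenceTime ν F hT'.le R f₀ →
      ∀ Ψ : Metric.ball f₀ 1 → C(Icc (0 : ℝ) T', X),
        (∀ x₀ : Metric.ball f₀ 1, IsCauchySolution ν F hT'.le R (x₀ : X) (Ψ x₀)) →
        ContinuousAt Ψ ⟨f₀, Metric.mem_ball_self one_pos⟩ ∧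
        ∀ L : ℝ, 0 < L → LipschitzConstOn T F (R + 1 + ‖f₀‖) L →
          Integrable (fun ω => Real.exp (L * (inverseSubordinator σ T' ω : ℝ))) P ∧
          ∀ x₀ : Metric.ball f₀ 1,
            ‖Ψ x₀ - Ψ ⟨f₀, Metric.mem_ball_self one_pos⟩‖ ≤ ‖(x₀ : X) - f₀‖ * phiExp P σ T' L := by
  have htop := hν.tendsto_atTop hν_top
  refine ⟨exists_isCommonExistenceTime hΦ hν htop hσ hσΦ hT hF_meas hA1 hA2 f₀ hR, ?_⟩
  intro T' hT' hT'T _ Ψ hΨ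
  have hsub : volume.restrict (Icc (0 : ℝ) T') ≤ volume.restrict (Icc 0 T) :=
    Measure.restrict_mono_set _ (Icc_subset_Icc_right hT'T)
  obtain ⟨K, hK, hFK⟩ := hA1 (R + 1 + ‖f₀‖)
  have hbound : ∀ L : ℝ, 0 < L → LipschitzConstOn T F (R + 1 + ‖f₀‖) L →
      ∀ x₀ : Metric.ball f₀ 1, ‖Ψ x₀ - Ψ ⟨f₀, Metric.mem_ball_self one_pos⟩‖ ≤
        ‖(x₀ : X) - f₀‖ * phiExp P σ T' L := by
    intro L hL0 hL x₀
    have hphi : 0 ≤ phiExp P σ T' L := integral_nonneg fun ω => by positivity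
    rw [ContinuousMap.norm_le _ (by positivity)]
    intro t
    have h := (hΨ x₀).enorm_sub_le hΦ hν htop hσ hσΦ hT' hK.le hL0
      (fun x => (hF_meas x).mono_measure hsub) (ae_mono hsub hFK) (hL.mono_time hT'T)
      (hΨ ⟨f₀, Metric.mem_ball_self one_pos⟩) (ball_subset_ball_of_mem x₀.2)
      (ball_subset_ball_of_mem (Metric.mem_ball_self one_pos)) t
    refine (ENNReal.ofReal_le_ofReal_iff (by positivity)).1 ?_
    rw [ENNReal.ofReal_mul (norm_nonneg _), ofReal_norm, ofReal_norm,
      ofReal_phiExp hΦ htop hσ hσΦ hL0]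
    -- The estimate at time `t` involves `V[0, t] ≤ V[0, T']`.
    refine h.trans ?_
    gcongr
    exact t.2.2
  refine ⟨?_, fun L hL0 hL => ⟨integrable_exp_inverseSubordinator hΦ htop hσ hσΦ hL0 T',
    hbound L hL0 hL⟩⟩
  obtain ⟨L, hL0, hL⟩ := hA2 (R + 1 + ‖f₀‖)
  rw [ContinuousAt, tendsto_iff_norm_sub_tendsto_zero]
  refine squeeze_zero (fun _ => norm_nonneg _) (hbound L hL0 hL) ?_
  have hc : Continuous fun x₀ : Metric.ball f₀ 1 => ‖(x₀ : X) - f₀‖ * phiExp P σ T' L := by fun_prop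
  simpa using hc.tendsto ⟨f₀, Metric.mem_ball_self one_pos⟩
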